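/- Let $n\ge 1$, let $\mathbb{B}_n$ be the open unit ball of $\mathbb{C}^n$, $V$ (or $|\cdot|$) Lebesgue measure, and $\langle z,w\rangle=\sum_i z_i\overline{w_i}$. The Bergman projection is $$Pf(z)=\frac{n!}{\pi^n}\int_{\mathbb{B}_n}\frac{f(w)}{(1-\langle z,w\rangle)^{n+1}}\,dV(w),\qquad z\in\mathbb{B}_n,$$ and $[g,P]f:=g\,Pf-P(gf)$. *Dyadic tents.* Fix $\theta_0>0$, put $\delta=e^{-2\theta_0}$ and $\rho(\zeta,\xi)=|1-\langle \zeta,\xi\rangle|$ on the sphere $\partial\mathbb{B}_n$. Fix finitely many dyadic systems $\mathcal{Q}_1,\dots,\mathcal{Q}_N$ on $\partial\mathbb{B}_n$. Each consists, for every $k=0,1,2,\dots$, of finitely many Borel sets $Q^k_j$ partitioning $\partial\mathbb{B}_n$ (for $k=0$ only the whole sphere), such that for $k\le l$ every $Q^l_i$ is either contained in or disjoint from $Q^k_j$, and such that each $Q^k_j$ has a reference point $x^k_j$ for which $Q^k_j$ contains the $\rho$-ball with center $x^k_j$ and radius $a\delta^k$ and is contained in the one with radius $A\delta^k$, with $a,A>0$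 independent of $k,j$. Together they approximate all balls: there is $A'>0$ such that every $\rho$-ball of radius $r>0$ with $A'r\le 1$ is contained in some $Q^k_j$ of one of the systems with $\delta^k\le A'r$. Let $d_\beta(z,0)=\frac12\log\frac{1+|z|}{1-|z|}$ be the Bergman distance to the origin, and let $P_k$ be the radial projection onto the sphere $\{d_\beta(z,0)=k\theta_0\}$. For each system define the kubes $$K^k_j=\{z\in\mathbb{B}_n:\ k\theta_0\le d_\beta(z,0)<(k+1)\theta_0,\ P_kz\in P_k(Q^k_j)\};$$ call $K^{k+1}_i$ a child of $K^k_j$ if $P_k(x^{k+1}_i)\in K^k_j$, and let the dyadic Carleson tent $\widehat K$ be the union of all descendants of $K$, including $K$. Let $\mathcal{D}$ be the collection of all kubes of all the systems. *Exponential oscillation.* For $1\le r<\infty$, a locally integrable $b:\mathbb{B}_n\to\mathbb{C}$ belongs to $\operatorname{osc}_{(\exp L)^r}$ if for some $c>0$ $$\sup_{K\in\mathcal{D}}\frac1{|\widehat K|}\int_{\widehat K}\exp\left(\left|\frac{b-\langle b\rangle_{\widehat K}}{c}\right|^r\right)dV<\infty,\qquad \langle b\rangle_{\widehat K}=\frac1{|\widehat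 K|}\int_{\widehat K}b\,dV,$$ and $\|b\|_{\operatorname{osc}_{(\exp L)^r}}$ is the infimum of the $c>0$ for which $$\sup_{K\in\mathcal{D}}\frac1{|\widehat K|}\int_{\widehat K}\left(\exp\left(\left|\frac{b-\langle b\rangle_{\widehat K}}{c}\right|^r\right)-1\right)dV\le 1.$$ **Theorem.** Let $\varepsilon\in(0,1]$. There is a constant $C>0$, depending only on $n$, $\varepsilon$ and the fixed dyadic structure, such that for every $b\in\operatorname{osc}_{(\exp L)^{1/\varepsilon}}$, every bounded measurable function $f$ with compact support in $\mathbb{B}_n$, and every $\lambda>0$, $$\left|\left\{z\in\mathbb{B}_n:\ |[\bar b,P]f(z)|>\lambda\right\}\right|\le C\,\|b\|_{\operatorname{osc}_{(\exp L)^{1/\varepsilon}}}\int_{\mathbb{B}_n}\frac{|f(z)|}{\lambda}\left(1+\log^+\left(\frac{|f(z)|\,\|b\|_{\operatorname{osc}_{(\exp L)^{1/\varepsilon}}}}{\lambda}\right)\right)^{\varepsilon}dV(z),$$ where $\log^+t=\max\{0,\log t\}$ and $\log^+0=0$. -/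

import Mathlib

open MeasureTheory Metric

namespace BergmanCommutator

/-- The space `ℂⁿ` with its Euclidean norm. Its `volume` is Lebesgue measure on `ℝ²ⁿ`, and
`inner ℂ w z = ∑ zᵢ * conj wᵢ` is the Hermitian product `⟨z, w⟩`, linear in `z`. -/
abbrev Cn (n : ℕ) : Type := EuclideanSpace ℂ (Fin n)

/-- The open unit ball of `ℂⁿ`. -/
def unitBall (n : ℕ) : Set (Cn n) := ball 0 1

/-- The unit sphere, the boundary of the unit ball. -/
def unitSphere (n : ℕ) : Set (Cn n) := sphere 0 1

/-! ### The Bergman projection and its commutators -/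

/-- The Bergman projection,
`P f (z) = (n! / πⁿ) ∫_{𝔹ₙ} f(w) / (1 - ⟨z, w⟩)ⁿ⁺¹ dV(w)`. -/
noncomputable def bergmanProj (n : ℕ) (f : Cn n → ℂ) (z : Cn n) : ℂ :=
  ((n.factorial : ℂ) / (Real.pi : ℂ) ^ n) *
    ∫ w in unitBall n, f w / (1 - inner ℂ w z) ^ (n + 1)

/-- The commutator `[g, P] f = g · P f - P (g · f)`. -/
noncomputable def commutator (n : ℕ) (g f : Cn n → ℂ) (z : Cn n) : ℂ :=
  g z * bergmanProj n f z - bergmanProj n (fun w => g w * f w) z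

/-! ### Dyadic systems on the sphere -/

/-- The ball `{ζ ∈ ∂𝔹ₙ : |1 - ⟨x, ζ⟩| < r}` of the quasi-metric `ρ(x, ζ) = |1 - ⟨x, ζ⟩|`. -/
def quasiBall {n : ℕ} (x : Cn n) (r : ℝ) : Set (Cn n) :=
  {ζ | ζ ∈ unitSphere n ∧ ‖1 - inner ℂ ζ x‖ < r}

/-- A dyadic system of Borel sets `Q_j^k` on the unit sphere, the sets of generation `k` having
scale `δ ^ k`, with reference points (`center`). Generation `0` consists of the whole sphere. -/
structure SphereDyadicSystem (n : ℕ) (δ : ℝ) where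
  /-- the number of sets of generation `k` -/
  card : ℕ → ℕ
  /-- the set `Q_j^k` -/
  cube : (k : ℕ) → Fin (card k) → Set (Cn n)
  /-- the reference point of `Q_j^k` -/
  center : (k : ℕ) → Fin (card k) → Cn n
  measurableSet_cube : ∀ k j, MeasurableSet (cube k j)
  center_mem : ∀ k j, center k j ∈ unitSphere n
  cube_zero : ∀ j, cube 0 j = unitSphere n
  iUnion_cube : ∀ k, ⋃ j, cube k j = unitSphere n
  disjoint_cube : ∀ k i j, i ≠ j → Disjoint (cube k i) (cube k j)
  nested : ∀ k l, k ≤ l → ∀ i j, cube l j ⊆ cube k i ∨ Disjoint (cube l j) (cube k i)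
  comparable : ∃ a A : ℝ, 0 < a ∧ 0 < A ∧ ∀ k j,
    quasiBall (center k j) (a * δ ^ k) ⊆ cube k j ∧
      cube k j ⊆ quasiBall (center k j) (A * δ ^ k)

/-- Finitely many dyadic systems on the unit sphere, of ratio `δ = exp (-2 θ₀)`, that together
approximate the balls of the quasi-metric: every small ball lies in a dyadic set of comparable
scale that belongs to one of the systems. -/
structure DyadicFamily (n : ℕ) (θ₀ : ℝ) where
  /-- the number of systems -/
  N : ℕ
  /-- the systems `𝒬_1, …, 𝒬_N` -/
  system : Fin N → SphereDyadicSystem n (Real.exp (-2 * θ₀))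
  approx : ∃ A : ℝ, 0 < A ∧ ∀ ζ ∈ unitSphere n, ∀ r : ℝ, 0 < r → A * r ≤ 1 →
    ∃ (ℓ : Fin N) (k : ℕ) (j : Fin ((system ℓ).card k)),
      quasiBall ζ r ⊆ (system ℓ).cube k j ∧ Real.exp (-2 * θ₀) ^ k ≤ A * r

/-! ### Kubes and dyadic Carleson tents in the ball -/

/-- The Bergman distance `d_β(z, 0)` of a point of the unit ball to the origin. -/
noncomputable def bergmanDistZero {n : ℕ} (z : Cn n) : ℝ :=
  1 / 2 * Real.log ((1 + ‖z‖) / (1 - ‖z‖))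

/-- The radial projection of `z` onto the Bergman sphere `{z : d_β(z, 0) = s}`, which is the
Euclidean sphere of radius `tanh s`. -/
noncomputable def radialProj {n : ℕ} (s : ℝ) (z : Cn n) : Cn n :=
  (Real.tanh s / ‖z‖) • z

namespace SphereDyadicSystem

variable {n : ℕ} {δ : ℝ}

/-- The indices `(k, j)` of the kubes of a dyadic system. -/
abbrev Kube (Q : SphereDyadicSystem n δ) : Type := (k : ℕ) × Fin (Q.card k)

/-- The kube `K_j^k`: the points `z` of the unit ball with `k θ₀ ≤ d_β(z, 0) < (k + 1) θ₀` whose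
projection `P_k z` to the Bergman sphere of radius `k θ₀` lies in `P_k (Q_j^k)`. For `k = 0` this
is the Bergman ball `{z : d_β(z, 0) < θ₀}`. -/
def kubeSet (Q : SphereDyadicSystem n δ) (θ₀ : ℝ) (K : Q.Kube) : Set (Cn n) :=
  {z | z ∈ unitBall n ∧ K.1 * θ₀ ≤ bergmanDistZero z ∧ bergmanDistZero z < (K.1 + 1) * θ₀ ∧
    radialProj (K.1 * θ₀) z ∈ radialProj (K.1 * θ₀) '' Q.cube K.1 K.2}

/-- The tree structure: `J` is a child of `K` if it belongs to the next generation and the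
projection of its center to the Bergman sphere of the generation of `K` lies in `K`. -/
def IsChild (Q : SphereDyadicSystem n δ) (θ₀ : ℝ) (J K : Q.Kube) : Prop :=
  J.1 = K.1 + 1 ∧ radialProj (K.1 * θ₀) (Q.center J.1 J.2) ∈ Q.kubeSet θ₀ K

/-- The dyadic Carleson tent: the union of all descendants of a kube (itself included). -/
def tent (Q : SphereDyadicSystem n δ) (θ₀ : ℝ) (K : Q.Kube) : Set (Cn n) :=
  {z | ∃ J : Q.Kube, Relation.ReflTransGen (Q.IsChild θ₀) J K ∧ z ∈ Q.kubeSet θ₀ J}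

end SphereDyadicSystem

/-! ### Exponential oscillation spaces -/

variable {n : ℕ} {θ₀ : ℝ}

/-- The supremum over all dyadic Carleson tents `T` (of all the systems) of the averages
`|T|⁻¹ ∫_T exp ((|b - ⟨b⟩_T| / c) ^ r) dV`, where `⟨b⟩_T` is the mean of `b` over `T`. If `b` is
not integrable on some `T`, the supremum is infinite, since so is the average over `T`. -/
noncomputable def expOscSup (D : DyadicFamily n θ₀) (b : Cn n → ℂ) (r c : ℝ) : ENNReal :=
  ⨆ (ℓ : Fin D.N) (K : (D.system ℓ).Kube),
    (volume ((D.system ℓ).tent θ₀ K))⁻¹ *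
      ∫⁻ w in (D.system ℓ).tent θ₀ K,
        ENNReal.ofReal (Real.exp ((‖b w - ⨍ u in (D.system ℓ).tent θ₀ K, b u‖ / c) ^ r))

/-- The space `osc_{(exp L)^r}`. -/
def MemOsc (D : DyadicFamily n θ₀) (r : ℝ) (b : Cn n → ℂ) : Prop :=
  LocallyIntegrableOn b (unitBall n) ∧ ∃ c : ℝ, 0 < c ∧ expOscSup D b r c < ⊤

/-- The (semi)norm of `osc_{(exp L)^r}`, of Luxemburg type for the Young function
`exp (t ^ r) - 1`: the infimum of the `c > 0` for which all averages of
`exp ((|b - ⟨b⟩_T| / c) ^ r) - 1` are at most `1`. -/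
noncomputable def oscNorm (D : DyadicFamily n θ₀) (r : ℝ) (b : Cn n → ℂ) : ℝ :=
  sInf {c : ℝ | 0 < c ∧ expOscSup D b r c ≤ 2}

end BergmanCommutator

namespace BergmanCommutator

open scoped ENNReal
-- The commutator is dominated by finitely many positive sparse operators, one per dyadic system,
-- and each of these satisfies the weak type bound.
--
-- Domination (`exists_enorm_commutator_le`). Any two points `z`, `w` of the ball lie in a common
-- tent `K` of generation `k` with `δ^k ≤ C |1 - ⟨z, w⟩|` (`exists_tent_of_mem_unitBall`), so the
-- kernel is at most a constant times `τ_K⁻¹`, where `τ_K = δ^(k(n+1))`. If `c` is admissible in the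
-- oscillation norm and `B_K = 1 + |b - ⟨b⟩_K| / c`, then `|b(z) - b(w)| ≤ c B_K(z) B_K(w)`. With `g
-- = c|f|/λ` this bounds the commutator by `C λ ∑ 1_K B_K y_K`, where `y_K = τ_K⁻¹ ∫_K B_K g`.
--
-- Weak type (`TentTree.exists_measure_tsum_indicator_le`). Put `F = g (1 + log⁺ g)^ε`. The tents
-- with `∫_K F > τ_K` cover a set of measure at most `C ∫ F`, because maximal tents are disjoint and
-- `|K| ≤ M τ_K`. The sum over the other tents is estimated in `L²`. The descendants of `K` that lie
-- `d` generations deeper fill only a fraction of order `δ^d` of `K`, and the exponential condition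
-- bounds `B_K` in `L⁴` on average. A weighted Cauchy–Schwarz inequality then removes the overlap of
-- the tents and leaves `∑ |K| y_K²`.
--
-- That sum converges by a Young inequality with a parameter (`one_add_mul_le`): if `∫_K F` is at
-- most `16^(-m) τ_K`, then `y_K` is at most a constant times `8^(-m)`. Tents at level `m` have
-- total measure at most a constant times `16^m ∫ F`, and `64^(-m) 16^m = 4^(-m)` is summable.
-- Volume of nonisotropic balls.
theorem volume_quasiPolydisc_le (n : ℕ) : ∃ C : ℝ, 0 < C ∧ ∀ x ∈ unitSphere n, ∀ R : ℝ, 0 < R →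
    volume {z | z ∈ unitBall n ∧ ‖1 - inner ℂ x z‖ < R} ≤ ENNReal.ofReal (C * R ^ (n + 1)) := by
  set B : Set (Cn n) := ball 0 3
  have hB : volume B ≠ ⊤ := measure_ball_lt_top.ne
  refine ⟨(volume B).toReal + 1, by positivity, fun x hx R hR => ?_⟩
  have hx1 : ‖x‖ = 1 := by simpa [unitSphere] using hx
  set a : ℂ := (Real.sqrt R : ℂ) with ha
  have hsq : 0 < Real.sqrt R := Real.sqrt_pos.2 hR
  have ha0 : a ≠ 0 := by simp [ha, hsq.ne']
  -- `L` multiplies `x` by `a² = R` and the complement of `x` by `a = √R`, so its complex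
  -- determinant is `a^(n+1)` and its real one `R^(n+1)`. A point of the set has the form `p x + w`
  -- with `w ⟂ x`, `|p - 1| < R` and `|w|² ≤ 1 - |p|² ≤ 2R`; hence the set lies in the translate by
  -- `x` of the image of a fixed ball.
  let φ : Module.Dual ℂ (Cn n) := (a - 1) • (innerSL ℂ x).toLinearMap
  let L : Cn n →ₗ[ℂ] Cn n := a • LinearMap.transvection φ x
  have hxx : inner ℂ x x = 1 := by simp [inner_self_eq_norm_sq_to_K, hx1]
  have hdet : LinearMap.det L = a ^ (n + 1) := by
    rw [LinearMap.det_smul, LinearMap.transvection.det φ x]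
    simp [φ, hx1, pow_succ]
  have hdetR : LinearMap.det (L.restrictScalars ℝ) = R ^ (n + 1) := by
    rw [LinearMap.det_restrictScalars, hdet, Algebra.norm_complex_apply, map_pow, ha,
      Complex.normSq_ofReal, Real.mul_self_sqrt hR.le]
  have hsub : {z | z ∈ unitBall n ∧ ‖1 - inner ℂ x z‖ < R} ⊆
      (fun y => x + y) '' ((L.restrictScalars ℝ) '' B) := by
    rintro z ⟨hz, hzR⟩
    have hz1 : ‖z‖ < 1 := by simpa [unitBall] using hz
    set p : ℂ := inner ℂ x z with hp
    set w : Cn n := z - p • x with hw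
    have hxw : inner ℂ x w = 0 := by
      rw [hw, inner_sub_right, inner_smul_right, hxx, ← hp]; ring
    have hwn : ‖w‖ ^ 2 ≤ 2 * R := by
      have h1 : ‖z‖ ^ 2 = ‖w‖ ^ 2 + ‖p‖ ^ 2 := by
        have h0 : z = w + p • x := by simp [hw]
        have := norm_add_sq_eq_norm_sq_add_norm_sq_of_inner_eq_zero (𝕜 := ℂ) w (p • x) (by
          rw [inner_smul_right, inner_eq_zero_symm.1 hxw, mul_zero])
        rw [← h0, norm_smul, hx1] at this
        nlinarith
      have h2 : 1 - ‖p‖ < R := by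
        have := norm_sub_norm_le (1 : ℂ) p
        simp only [norm_one] at this
        linarith
      nlinarith [norm_nonneg z, sq_nonneg (1 - ‖p‖)]
    refine ⟨z - x, ⟨a⁻¹ • w + (a⁻¹ ^ 2 * (p - 1)) • x, ?_, ?_⟩, by simp⟩
    · have e1 : ‖a⁻¹ • w‖ ≤ 3 / 2 := by
        rw [norm_smul, norm_inv, ha, Complex.norm_real, Real.norm_of_nonneg hsq.le,
          inv_mul_le_iff₀ hsq]
        refine abs_le_of_sq_le_sq' ?_ (by positivity) |>.2
        rw [mul_pow, Real.sq_sqrt hR.le]; linarith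
      have e2 : ‖(a⁻¹ ^ 2 * (p - 1)) • x‖ < 1 := by
        rw [norm_smul, hx1, mul_one, norm_mul, norm_pow, norm_inv, ha, Complex.norm_real,
          Real.norm_of_nonneg hsq.le, inv_pow, Real.sq_sqrt hR.le, inv_mul_lt_iff₀ hR, mul_one,
          norm_sub_rev]
        exact hzR
      have := norm_add_le (a⁻¹ • w) ((a⁻¹ ^ 2 * (p - 1)) • x)
      simp only [B, mem_ball_zero_iff]
      linarith
    · have e : φ (a⁻¹ • w + (a⁻¹ ^ 2 * (p - 1)) • x) = (a - 1) * (a⁻¹ ^ 2 * (p - 1)) := by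
        simp [φ, hxw, inner_add_right, inner_smul_right, hx1]
      have e3 : z = w + p • x := by simp [hw]
      simp only [LinearMap.restrictScalars_apply, L, LinearMap.smul_apply,
        LinearMap.transvection.apply, e]
      rw [e3]
      match_scalars
      · field_simp
      · field_simp; ring
  calc _ ≤ volume ((fun y => x + y) '' ((L.restrictScalars ℝ) '' B)) := measure_mono hsub
    _ = ENNReal.ofReal (R ^ (n + 1)) * volume B := by
      rw [Set.image_add_left, measure_preimage_add, Measure.addHaar_image_linearMap, hdetR,
        abs_of_pos (by positivity)]
    _ ≤ ENNReal.ofReal (R ^ (n + 1)) * ENNReal.ofReal ((volume B).toReal + 1) := by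
      gcongr
      rw [← ENNReal.ofReal_toReal hB]
      exact ENNReal.ofReal_le_ofReal (by simp)
    _ = _ := by rw [← ENNReal.ofReal_mul (by positivity), mul_comm]

/-! ### Bergman distance and Euclidean radius: `1 - tanh s` is comparable to `exp (-2s)`. -/

theorem one_sub_tanh (s : ℝ) :
    1 - Real.tanh s = 2 * Real.exp (-2 * s) / (1 + Real.exp (-2 * s)) := by
  have h1 : Real.exp (-2 * s) = Real.exp (-s) * Real.exp (-s) := by
    rw [← Real.exp_add]; ring_nf
  have h2 : Real.exp s * Real.exp (-s) = 1 := by rw [← Real.exp_add]; simp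
  have h3 := Real.exp_pos s
  have h4 := Real.exp_pos (-s)
  rw [Real.tanh_eq, h1]
  generalize Real.exp s = u at *
  generalize Real.exp (-s) = v at *
  have hu : u = 1 / v := by field_simp; exact h2
  subst hu
  field_simp
  ring

theorem exp_le_one_sub_tanh {s : ℝ} (hs : 0 ≤ s) : Real.exp (-2 * s) ≤ 1 - Real.tanh s := by
  have h : Real.exp (-2 * s) ≤ 1 := Real.exp_le_one_iff.2 (by linarith)
  have h' := Real.exp_pos (-2 * s)
  rw [one_sub_tanh, le_div_iff₀ (by positivity)]
  nlinarith

theorem one_sub_tanh_le (s : ℝ) : 1 - Real.tanh s ≤ 2 * Real.exp (-2 * s) := by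
  have h' := Real.exp_pos (-2 * s)
  rw [one_sub_tanh]
  exact div_le_self (by positivity) (by linarith)

theorem exp_neg_two_mul_pow (θ₀ : ℝ) (k : ℕ) :
    Real.exp (-2 * θ₀) ^ k = Real.exp (-2 * (k * θ₀)) := by
  rw [← Real.exp_nat_mul]; ring_nf

theorem tanh_nonneg_of_nonneg {s : ℝ} (hs : 0 ≤ s) : 0 ≤ Real.tanh s := by
  have h : Real.exp (-2 * s) ≤ 1 := Real.exp_le_one_iff.2 (by linarith)
  have h' := Real.exp_pos (-2 * s)
  have := one_sub_tanh s
  have : 2 * Real.exp (-2 * s) / (1 + Real.exp (-2 * s)) ≤ 1 := by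
    rw [div_le_one (by positivity)]; linarith
  linarith

theorem bergmanDistZero_eq_artanh {n : ℕ} {z : Cn n} (hz : z ∈ unitBall n) :
    bergmanDistZero z = Real.artanh ‖z‖ := by
  have hz1 : ‖z‖ < 1 := by simpa [unitBall] using hz
  rw [bergmanDistZero, Real.artanh_eq_half_log ⟨by linarith [norm_nonneg z], hz1.le⟩]

theorem tanh_mem_Ioo (s : ℝ) : Real.tanh s ∈ Set.Ioo (-1) 1 := by
  have h' := Real.exp_pos (-2 * s)
  have := one_sub_tanh s
  have h2 : 0 < 2 * Real.exp (-2 * s) / (1 + Real.exp (-2 * s)) := by positivity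
  have h3 : 2 * Real.exp (-2 * s) / (1 + Real.exp (-2 * s)) < 2 := by
    rw [div_lt_iff₀ (by positivity)]; linarith
  constructor <;> linarith

theorem le_bergmanDistZero_iff {n : ℕ} {z : Cn n} (hz : z ∈ unitBall n) (s : ℝ) :
    s ≤ bergmanDistZero z ↔ Real.tanh s ≤ ‖z‖ := by
  have hz1 : ‖z‖ < 1 := by simpa [unitBall] using hz
  rw [bergmanDistZero_eq_artanh hz, ← Real.artanh_le_artanh_iff (tanh_mem_Ioo s)
    ⟨by linarith [norm_nonneg z], hz1⟩, Real.artanh_tanh]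

/-! ### Tents as truncated cones. -/

/-- The cone over a set of directions, with its vertex. -/
def cone {n : ℕ} (Q : Set (Cn n)) : Set (Cn n) := {z | z = 0 ∨ ‖z‖⁻¹ • z ∈ Q}

theorem smul_mem_cone_iff {n : ℕ} {Q : Set (Cn n)} {t : ℝ} (ht : 0 < t) {z : Cn n} :
    t • z ∈ cone Q ↔ z ∈ cone Q := by
  simp only [cone, Set.mem_ofPred_eq, smul_eq_zero, ht.ne', false_or, norm_smul, smul_smul,
    Real.norm_of_nonneg ht.le, mul_inv]
  rw [mul_assoc, mul_comm, mul_assoc, mul_inv_cancel₀ ht.ne', mul_one]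

theorem measurableSet_cone {n : ℕ} {Q : Set (Cn n)} (hQ : MeasurableSet Q) :
    MeasurableSet (cone Q) := by
  have : cone Q = {0} ∪ (fun z : Cn n => ‖z‖⁻¹ • z) ⁻¹' Q := by
    ext z; simp [cone]
  rw [this]
  exact (measurableSet_singleton 0).union ((by fun_prop : Measurable _) hQ)

theorem inv_norm_smul_mem_unitSphere {n : ℕ} {z : Cn n} (hz : z ≠ 0) :
    ‖z‖⁻¹ • z ∈ unitSphere n := by
  simp [unitSphere, norm_smul, hz]

theorem unitSphere_nonempty {n : ℕ} (hn : 1 ≤ n) : (unitSphere n).Nonempty :=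
  ⟨EuclideanSpace.single ⟨0, hn⟩ 1, by simp [unitSphere]⟩

namespace SphereDyadicSystem

variable {n : ℕ} {δ : ℝ}

theorem cube_subset (Q : SphereDyadicSystem n δ) (k : ℕ) (j : Fin (Q.card k)) :
    Q.cube k j ⊆ unitSphere n := by
  rw [← Q.iUnion_cube k]; exact Set.subset_iUnion _ j

theorem mem_cone_cube_zero (Q : SphereDyadicSystem n δ) (j : Fin (Q.card 0)) (z : Cn n) :
    z ∈ cone (Q.cube 0 j) := by
  by_cases hz : z = 0
  · exact Or.inl hz
  · exact Or.inr (Q.cube_zero j ▸ inv_norm_smul_mem_unitSphere hz)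

theorem center_mem_cube (Q : SphereDyadicSystem n δ) (hδ : 0 < δ) (k : ℕ) (j : Fin (Q.card k)) :
    Q.center k j ∈ Q.cube k j := by
  obtain ⟨a, A, ha, -, h⟩ := Q.comparable
  refine (h k j).1 ⟨Q.center_mem k j, ?_⟩
  have : ‖Q.center k j‖ = 1 := by simpa [unitSphere] using Q.center_mem k j
  simp only [inner_self_eq_norm_sq_to_K, this]
  simp only [RCLike.ofReal_one, one_pow, sub_self, norm_zero]
  positivity

theorem subset_of_mem (Q : SphereDyadicSystem n δ) {k l : ℕ} (hkl : k ≤ l) {i : Fin (Q.card k)}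
    {j : Fin (Q.card l)} {z : Cn n} (hi : z ∈ Q.cube k i) (hj : z ∈ Q.cube l j) :
    Q.cube l j ⊆ Q.cube k i :=
  (Q.nested k l hkl i j).resolve_right fun h => Set.disjoint_left.1 h hj hi

theorem exists_mem_cube (Q : SphereDyadicSystem n δ) (k : ℕ) {z : Cn n} (hz : z ∈ unitSphere n) :
    ∃ j, z ∈ Q.cube k j := by
  rw [← Q.iUnion_cube k] at hz; exact Set.mem_iUnion.1 hz

theorem eq_of_mem (Q : SphereDyadicSystem n δ) {k : ℕ} {i j : Fin (Q.card k)} {z : Cn n}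
    (hi : z ∈ Q.cube k i) (hj : z ∈ Q.cube k j) : i = j := by
  by_contra h
  exact Set.disjoint_left.1 (Q.disjoint_cube k i j h) hi hj

theorem eq_of_card_zero (Q : SphereDyadicSystem n δ) (hn : 1 ≤ n) (i j : Fin (Q.card 0)) :
    i = j := by
  obtain ⟨z, hz⟩ := unitSphere_nonempty hn
  exact Q.eq_of_mem (Q.cube_zero i ▸ hz) (Q.cube_zero j ▸ hz)

/-- In generation `0` the radial projection sends everything to the origin and its condition is
void; this agrees with the cone over the whole sphere only because cones contain their vertex. -/
theorem mem_kubeSet_iff (Q : SphereDyadicSystem n δ) (hn : 1 ≤ n) {θ₀ : ℝ} (hθ : 0 < θ₀)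
    (K : Q.Kube) (z : Cn n) :
    z ∈ Q.kubeSet θ₀ K ↔ z ∈ unitBall n ∧ K.1 * θ₀ ≤ bergmanDistZero z ∧
      bergmanDistZero z < (K.1 + 1) * θ₀ ∧ z ∈ cone (Q.cube K.1 K.2) := by
  refine and_congr_right fun hz => and_congr_right fun h1 => and_congr_right fun _ => ?_
  obtain ⟨k, j⟩ := K
  rcases Nat.eq_zero_or_pos k with rfl | hk
  · refine iff_of_true ?_ (Q.mem_cone_cube_zero j z)
    obtain ⟨w, hw⟩ := unitSphere_nonempty hn
    exact ⟨w, by rw [Q.cube_zero]; exact hw, by simp [radialProj]⟩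
  · have hs : 0 < (k : ℝ) * θ₀ := by positivity
    rw [le_bergmanDistZero_iff hz] at h1
    have ht : 0 < Real.tanh (k * θ₀) := by
      rw [Real.tanh_eq_sinh_div_cosh]
      exact div_pos (Real.sinh_pos_iff.2 hs) (Real.cosh_pos _)
    have hz0 : 0 < ‖z‖ := ht.trans_le h1
    constructor
    · rintro ⟨q, hq, he⟩
      have hq1 : ‖q‖ = 1 := by simpa [unitSphere] using Q.cube_subset _ _ hq
      right
      simp only [radialProj, hq1, div_eq_mul_inv, mul_smul, mul_one, inv_one] at he
      have := smul_right_injective (Cn n) ht.ne' he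
      rwa [← this]
    · rintro (h | h)
      · simp [h] at hz0
      · refine ⟨_, h, ?_⟩
        simp only [radialProj, norm_smul, norm_inv, norm_norm, inv_mul_cancel₀ hz0.ne',
          smul_smul, div_eq_mul_inv, inv_one, mul_one]

theorem isChild_iff (Q : SphereDyadicSystem n δ) (hn : 1 ≤ n) {θ₀ : ℝ} (hθ : 0 < θ₀)
    (J K : Q.Kube) :
    Q.IsChild θ₀ J K ↔ J.1 = K.1 + 1 ∧ Q.center J.1 J.2 ∈ Q.cube K.1 K.2 := by
  refine and_congr_right fun _ => ?_
  rw [mem_kubeSet_iff Q hn hθ]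
  set x := Q.center J.1 J.2
  have hx : x ∈ unitSphere n := Q.center_mem _ _
  have hx1 : ‖x‖ = 1 := by simpa [unitSphere] using hx
  have hx0 : x ≠ 0 := by intro h; simp [h] at hx1
  set s : ℝ := K.1 * θ₀
  have hs0 : 0 ≤ s := by positivity
  have hn' : ‖radialProj s x‖ = Real.tanh s := by
    simp [radialProj, norm_smul, hx1, abs_of_nonneg (tanh_nonneg_of_nonneg hs0)]
  have hb : radialProj s x ∈ unitBall n := by
    simpa [unitBall, hn'] using (tanh_mem_Ioo s).2
  have hd : bergmanDistZero (radialProj s x) = s := by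
    rw [bergmanDistZero_eq_artanh hb, hn', Real.artanh_tanh]
  have e : radialProj s x ∈ cone (Q.cube K.1 K.2) ↔ x ∈ Q.cube K.1 K.2 := by
    rcases Nat.eq_zero_or_pos K.1 with h0 | hk
    · obtain ⟨k, j⟩ := K
      subst h0
      exact iff_of_true (Q.mem_cone_cube_zero j _) (by rw [Q.cube_zero]; exact hx)
    · have hs : 0 < s := by positivity
      have ht : 0 < Real.tanh s := by
        rw [Real.tanh_eq_sinh_div_cosh]
        exact div_pos (Real.sinh_pos_iff.2 hs) (Real.cosh_pos _)
      rw [radialProj, smul_mem_cone_iff (by rw [hx1]; simpa using ht)]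
      simp [cone, hx0, hx1]
  rw [hd, e]
  exact ⟨fun h => h.2.2.2, fun h => ⟨hb, le_rfl, by simp only [s]; nlinarith, h⟩⟩

theorem reflTransGen_isChild (Q : SphereDyadicSystem n δ) (hn : 1 ≤ n) (hδ : 0 < δ) {θ₀ : ℝ}
    (hθ : 0 < θ₀) {J K : Q.Kube} (h : Relation.ReflTransGen (Q.IsChild θ₀) J K) :
    K.1 ≤ J.1 ∧ Q.cube J.1 J.2 ⊆ Q.cube K.1 K.2 := by
  induction h with
  | refl => exact ⟨le_rfl, subset_rfl⟩
  | @tail L M _ h ih =>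
    rw [isChild_iff Q hn hθ] at h
    exact ⟨by omega, ih.2.trans (Q.subset_of_mem (by omega) h.2 (Q.center_mem_cube hδ _ _))⟩

theorem reflTransGen_isChild_of_subset (Q : SphereDyadicSystem n δ) (hn : 1 ≤ n) (hδ : 0 < δ)
    {θ₀ : ℝ} (hθ : 0 < θ₀) {k : ℕ} (i : Fin (Q.card k)) (d : ℕ) (j : Fin (Q.card (k + d)))
    {z : Cn n} (hi : z ∈ Q.cube k i) (hj : z ∈ Q.cube (k + d) j) :
    Relation.ReflTransGen (Q.IsChild θ₀) ⟨k + d, j⟩ ⟨k, i⟩ := by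
  induction d with
  | zero => rw [Q.eq_of_mem hi hj]; rfl
  | succ d ih =>
    obtain ⟨l, hl⟩ := Q.exists_mem_cube (k + d) (Q.cube_subset _ _ hi)
    refine Relation.ReflTransGen.head ?_ (ih l hl)
    rw [isChild_iff Q hn hθ]
    exact ⟨rfl, Q.subset_of_mem (by omega) hl hj (Q.center_mem_cube hδ _ _)⟩

/-- Cubes shrink along descendants, which gives one inclusion. For the other, a point at Bergman
distance `s` lies in a kube of generation `⌊s / θ₀⌋` over its direction, and nestedness of the cubes
makes that kube a descendant. -/
theorem mem_tent_iff (Q : SphereDyadicSystem n δ) (hn : 1 ≤ n) (hδ : 0 < δ) {θ₀ : ℝ}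
    (hθ : 0 < θ₀) (K : Q.Kube) (z : Cn n) :
    z ∈ Q.tent θ₀ K ↔ z ∈ unitBall n ∧ Real.tanh (K.1 * θ₀) ≤ ‖z‖ ∧
      z ∈ cone (Q.cube K.1 K.2) := by
  constructor
  · rintro ⟨J, hJ, hz⟩
    obtain ⟨h1, h2⟩ := Q.reflTransGen_isChild hn hδ hθ hJ
    rw [mem_kubeSet_iff Q hn hθ] at hz
    refine ⟨hz.1, ?_, hz.2.2.2.imp id fun h => h2 h⟩
    rw [← le_bergmanDistZero_iff hz.1]
    refine le_trans ?_ hz.2.1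
    gcongr
  · rintro ⟨hz, h1, h2⟩
    rw [← le_bergmanDistZero_iff hz] at h1
    obtain ⟨k, i⟩ := K
    set m := ⌊bergmanDistZero z / θ₀⌋₊ with hm
    have hd0 : 0 ≤ bergmanDistZero z := le_trans (by positivity) h1
    have hm1 : m * θ₀ ≤ bergmanDistZero z := by
      rw [← le_div_iff₀ hθ]; exact Nat.floor_le (by positivity)
    have hm2 : bergmanDistZero z < (m + 1) * θ₀ := by
      rw [← div_lt_iff₀ hθ]; exact Nat.lt_floor_add_one _
    have hkm : k ≤ m := by
      apply Nat.le_floor; rw [le_div_iff₀ hθ]; exact h1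
    obtain ⟨d, hd⟩ := Nat.exists_eq_add_of_le hkm
    rw [hd] at hm1 hm2
    by_cases hz0 : z = 0
    · have hd0 : d = 0 := by
        by_contra hne
        rw [le_bergmanDistZero_iff hz, hz0, norm_zero, ← not_lt] at hm1
        apply hm1
        rw [Real.tanh_eq_sinh_div_cosh]
        refine div_pos (Real.sinh_pos_iff.2 ?_) (Real.cosh_pos _)
        have : 0 < k + d := by omega
        positivity
      subst hd0
      exact ⟨⟨k, i⟩, .refl, (mem_kubeSet_iff Q hn hθ _ _).2 ⟨hz, hm1, hm2, h2⟩⟩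
    · have h2' := h2.resolve_left hz0
      obtain ⟨j, hj⟩ := Q.exists_mem_cube (k + d) (inv_norm_smul_mem_unitSphere hz0)
      exact ⟨⟨k + d, j⟩, Q.reflTransGen_isChild_of_subset hn hδ hθ i d j h2' hj,
        (mem_kubeSet_iff Q hn hθ _ _).2 ⟨hz, hm1, hm2, Or.inr hj⟩⟩

end SphereDyadicSystem

/-! ### Volumes of tents. -/

open Pointwise in
theorem volume_cone_inter_ball {n : ℕ} (hn : 1 ≤ n) (Q : Set (Cn n)) {r : ℝ} (hr : 0 ≤ r) :
    volume (cone Q ∩ ball 0 r) = ENNReal.ofReal (r ^ (2 * n)) * volume (cone Q ∩ ball 0 1) := by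
  rcases hr.eq_or_lt with rfl | hr
  · simp [zero_pow (show 2 * n ≠ 0 by omega)]
  · have : cone Q ∩ ball 0 r = r • (cone Q ∩ ball 0 1) := by
      ext z
      rw [Set.mem_smul_set_iff_inv_smul_mem₀ hr.ne']
      simp only [Set.mem_inter_iff, smul_mem_cone_iff (inv_pos.2 hr), mem_ball_zero_iff, norm_smul,
        norm_inv, Real.norm_of_nonneg hr.le, inv_mul_lt_iff₀ hr, mul_one]
    rw [this, Measure.addHaar_smul, abs_of_pos (by positivity)]
    simp [finrank_real_of_complex]

theorem volume_cone_inter_shell {n : ℕ} (hn : 1 ≤ n) {Q : Set (Cn n)} (hQ : MeasurableSet Q)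
    {r : ℝ} (hr : 0 ≤ r) (hr1 : r ≤ 1) :
    volume {z | z ∈ unitBall n ∧ r ≤ ‖z‖ ∧ z ∈ cone Q} =
      ENNReal.ofReal (1 - r ^ (2 * n)) * volume (cone Q ∩ ball 0 1) := by
  have : {z | z ∈ unitBall n ∧ r ≤ ‖z‖ ∧ z ∈ cone Q} =
      (cone Q ∩ ball 0 1) \ (cone Q ∩ ball 0 r) := by
    ext z
    simp only [unitBall, Set.mem_ofPred_eq, Set.mem_sdiff, Set.mem_inter_iff, mem_ball_zero_iff,
      not_and, not_lt]
    tauto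
  have hfin : ∀ s : ℝ, volume (cone Q ∩ ball 0 s) ≠ ⊤ := fun s =>
    (measure_mono Set.inter_subset_right |>.trans_lt measure_ball_lt_top).ne
  rw [this, measure_sdiff (Set.inter_subset_inter_right _ (ball_subset_ball hr1))
    ((measurableSet_cone hQ).inter measurableSet_ball).nullMeasurableSet (hfin r),
    volume_cone_inter_ball hn Q hr, ENNReal.ofReal_sub _ (by positivity), ENNReal.sub_mul,
    ENNReal.ofReal_one, one_mul]
  exact fun _ _ => hfin 1

namespace SphereDyadicSystem

variable {n : ℕ} {θ₀ : ℝ}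

theorem tent_eq (Q : SphereDyadicSystem n (Real.exp (-2 * θ₀))) (hn : 1 ≤ n) (hθ : 0 < θ₀)
    (K : Q.Kube) :
    Q.tent θ₀ K = {z | z ∈ unitBall n ∧ Real.tanh (K.1 * θ₀) ≤ ‖z‖ ∧
      z ∈ cone (Q.cube K.1 K.2)} :=
  Set.ext fun z => Q.mem_tent_iff hn (Real.exp_pos _) hθ K z

theorem tent_subset_unitBall (Q : SphereDyadicSystem n (Real.exp (-2 * θ₀))) (K : Q.Kube) :
    Q.tent θ₀ K ⊆ unitBall n := by
  rintro z ⟨J, -, hz⟩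
  exact hz.1

theorem measurableSet_tent (Q : SphereDyadicSystem n (Real.exp (-2 * θ₀))) (hn : 1 ≤ n)
    (hθ : 0 < θ₀) (K : Q.Kube) : MeasurableSet (Q.tent θ₀ K) := by
  rw [Q.tent_eq hn hθ]
  exact measurableSet_ball.inter ((measurableSet_le measurable_const measurable_norm).inter
    (measurableSet_cone (Q.measurableSet_cube _ _)))

theorem tanh_le_norm_of_mem_tent (Q : SphereDyadicSystem n (Real.exp (-2 * θ₀))) (hn : 1 ≤ n)
    (hθ : 0 < θ₀) {K : Q.Kube} {z : Cn n} (hz : z ∈ Q.tent θ₀ K) :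
    Real.tanh (K.1 * θ₀) ≤ ‖z‖ := ((Q.mem_tent_iff hn (Real.exp_pos _) hθ K z).1 hz).2.1

theorem tanh_pos_of_pos {s : ℝ} (hs : 0 < s) : 0 < Real.tanh s := by
  rw [Real.tanh_eq_sinh_div_cosh]
  exact div_pos (Real.sinh_pos_iff.2 hs) (Real.cosh_pos _)

theorem tent_subset_tent (Q : SphereDyadicSystem n (Real.exp (-2 * θ₀))) (hn : 1 ≤ n)
    (hθ : 0 < θ₀) {J K : Q.Kube} (hKJ : K.1 ≤ J.1) {z : Cn n} (hJ : z ∈ Q.tent θ₀ J)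
    (hK : z ∈ Q.tent θ₀ K) : Q.tent θ₀ J ⊆ Q.tent θ₀ K := by
  intro w hw
  rw [Q.mem_tent_iff hn (Real.exp_pos _) hθ] at *
  have htanh : Real.tanh (K.1 * θ₀) ≤ Real.tanh (J.1 * θ₀) := by
    have h := Real.exp_le_exp.2 (show -2 * (J.1 * θ₀) ≤ -2 * (K.1 * θ₀) by
      have : (K.1 : ℝ) * θ₀ ≤ J.1 * θ₀ := by gcongr
      linarith)
    have h1 := one_sub_tanh (K.1 * θ₀)
    have h2 := one_sub_tanh (J.1 * θ₀)
    have h3 := Real.exp_pos (-2 * (J.1 * θ₀))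
    have h4 := Real.exp_pos (-2 * (K.1 * θ₀))
    have : 2 * Real.exp (-2 * (J.1 * θ₀)) / (1 + Real.exp (-2 * (J.1 * θ₀))) ≤
        2 * Real.exp (-2 * (K.1 * θ₀)) / (1 + Real.exp (-2 * (K.1 * θ₀))) := by
      rw [div_le_div_iff₀ (by positivity) (by positivity)]
      nlinarith
    linarith
  refine ⟨hw.1, htanh.trans hw.2.1, ?_⟩
  rcases hJ.2.2 with h0 | hj
  · have : K.1 = 0 := by
      by_contra hne
      have : 0 < (K.1 : ℝ) * θ₀ := by positivity
      have := tanh_pos_of_pos this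
      simp only [h0, norm_zero] at hK
      linarith [hK.2.1]
    obtain ⟨k, j⟩ := K
    subst this
    exact Q.mem_cone_cube_zero j w
  · rcases hK.2.2 with h0 | hk
    · obtain ⟨k, i⟩ := K
      have : k = 0 := by
        by_contra hne
        have : 0 < (k : ℝ) * θ₀ := by positivity
        have := tanh_pos_of_pos this
        simp only [h0, norm_zero] at hK
        linarith [hK.2.1]
      subst this
      exact Q.mem_cone_cube_zero i w
    · exact hw.2.2.imp id fun h => Q.subset_of_mem hKJ hk hj h

theorem eq_of_mem_tent (Q : SphereDyadicSystem n (Real.exp (-2 * θ₀))) (hn : 1 ≤ n)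
    (hθ : 0 < θ₀) {k : ℕ} {i j : Fin (Q.card k)} {z : Cn n} (hi : z ∈ Q.tent θ₀ ⟨k, i⟩)
    (hj : z ∈ Q.tent θ₀ ⟨k, j⟩) : i = j := by
  rw [Q.mem_tent_iff hn (Real.exp_pos _) hθ] at *
  rcases Nat.eq_zero_or_pos k with rfl | hk
  · exact Q.eq_of_card_zero hn i j
  · have h0 : z ≠ 0 := by
      rintro rfl
      have : 0 < (k : ℝ) * θ₀ := by positivity
      have := tanh_pos_of_pos this
      simp only [norm_zero] at hi
      linarith [hi.2.1]
    exact Q.eq_of_mem (hi.2.2.resolve_left h0) (hj.2.2.resolve_left h0)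

/-- The part of a tent at most `δᵐ` away from the sphere is a fraction `δᵐ⁻ᵏ` of the tent. -/
theorem volume_tent_inter_le (Q : SphereDyadicSystem n (Real.exp (-2 * θ₀))) (hn : 1 ≤ n)
    (hθ : 0 < θ₀) (K : Q.Kube) (d : ℕ) :
    volume (Q.tent θ₀ K ∩ {z | Real.tanh ((K.1 + d : ℕ) * θ₀) ≤ ‖z‖}) ≤
      ENNReal.ofReal (4 * n * Real.exp (-2 * θ₀) ^ d) * volume (Q.tent θ₀ K) := by
  set r := Real.tanh ((K.1 + d : ℕ) * θ₀) with hr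
  set s := Real.tanh (K.1 * θ₀) with hs
  have hr0 : 0 ≤ r := tanh_nonneg_of_nonneg (by positivity)
  have hs0 : 0 ≤ s := tanh_nonneg_of_nonneg (by positivity)
  have hr1 : r ≤ 1 := (tanh_mem_Ioo _).2.le
  have hs1 : s ≤ 1 := (tanh_mem_Ioo _).2.le
  have hsub : Q.tent θ₀ K ∩ {z | r ≤ ‖z‖} ⊆
      {z | z ∈ unitBall n ∧ r ≤ ‖z‖ ∧ z ∈ cone (Q.cube K.1 K.2)} := by
    rintro z ⟨hz, hz'⟩
    rw [Q.mem_tent_iff hn (Real.exp_pos _) hθ] at hz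
    exact ⟨hz.1, hz', hz.2.2⟩
  refine (measure_mono hsub).trans ?_
  rw [volume_cone_inter_shell hn (Q.measurableSet_cube _ _) hr0 hr1, Q.tent_eq hn hθ,
    volume_cone_inter_shell hn (Q.measurableSet_cube _ _) hs0 hs1, ← mul_assoc,
    ← ENNReal.ofReal_mul (by positivity)]
  gcongr
  -- Both volumes are multiples of the volume of the same cone sector, so only the radial factors
  -- matter. Bernoulli's inequality gives `1 - r^(2n) ≤ 4n δ^(k+d)`, while `1 - s^(2n) ≥ 1 - s ≥
  -- δ^k`.
  have h1 : 1 - r ^ (2 * n) ≤ 2 * n * (1 - r) := by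
    have := one_add_mul_le_pow (show -2 ≤ r - 1 by linarith) (2 * n)
    rw [add_sub_cancel] at this
    push_cast at this
    linarith
  have h2 : 1 - r ≤ 2 * (Real.exp (-2 * θ₀) ^ d * Real.exp (-2 * θ₀) ^ K.1) := by
    rw [← pow_add, add_comm, exp_neg_two_mul_pow]
    exact one_sub_tanh_le _
  have h3 : Real.exp (-2 * θ₀) ^ K.1 ≤ 1 - s := by
    rw [exp_neg_two_mul_pow]; exact exp_le_one_sub_tanh (by positivity)
  have h4 : s ^ (2 * n) ≤ s := pow_le_of_le_one hs0 hs1 (by omega)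
  calc 1 - r ^ (2 * n) ≤ 2 * n * (2 * (Real.exp (-2 * θ₀) ^ d * Real.exp (-2 * θ₀) ^ K.1)) := by
        refine h1.trans ?_; gcongr
    _ = 4 * n * Real.exp (-2 * θ₀) ^ d * Real.exp (-2 * θ₀) ^ K.1 := by ring
    _ ≤ _ := by gcongr; linarith

theorem exists_volume_tent_le (Q : SphereDyadicSystem n (Real.exp (-2 * θ₀))) (hn : 1 ≤ n)
    (hθ : 0 < θ₀) : ∃ C : ℝ, 0 < C ∧ ∀ K : Q.Kube,
      volume (Q.tent θ₀ K) ≤ ENNReal.ofReal (C * Real.exp (-2 * θ₀) ^ (K.1 * (n + 1))) := by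
  obtain ⟨C, hC, h⟩ := volume_quasiPolydisc_le n
  obtain ⟨a, A, -, hA, hQ⟩ := Q.comparable
  have hvol : volume (unitBall n) ≠ ⊤ := measure_ball_lt_top.ne
  refine ⟨C * (A + 2) ^ (n + 1) + (volume (unitBall n)).toReal, by positivity, fun K => ?_⟩
  rcases Nat.eq_zero_or_pos K.1 with h0 | hk
  · rw [h0, zero_mul, pow_zero, mul_one]
    refine (measure_mono (Q.tent_subset_unitBall K)).trans ?_
    rw [← ENNReal.ofReal_toReal hvol]
    exact ENNReal.ofReal_le_ofReal (by simp; positivity)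
  -- The direction `ζ` of `z` is within `A δ^k` of the center, and passing from `ζ` to `z` costs at
  -- most `1 - |z| ≤ 2 δ^k`.
  · have hsub : Q.tent θ₀ K ⊆ {z | z ∈ unitBall n ∧
        ‖1 - inner ℂ (Q.center K.1 K.2) z‖ < (A + 2) * Real.exp (-2 * θ₀) ^ K.1} := by
      intro z hz
      rw [Q.mem_tent_iff hn (Real.exp_pos _) hθ] at hz
      obtain ⟨hz, h1, h2⟩ := hz
      have hz1 : ‖z‖ < 1 := by simpa [unitBall] using hz
      have hs : 0 < (K.1 : ℝ) * θ₀ := by positivity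
      have hz0 : 0 < ‖z‖ := (tanh_pos_of_pos hs).trans_le h1
      have hx : ‖Q.center K.1 K.2‖ = 1 := by simpa [unitSphere] using Q.center_mem K.1 K.2
      have hζ := ((hQ K.1 K.2).2 (h2.resolve_left (norm_pos_iff.1 hz0))).2
      refine ⟨hz, ?_⟩
      set x := Q.center K.1 K.2
      set ζ := ‖z‖⁻¹ • z
      have hzζ : z = ((‖z‖ : ℝ) : ℂ) • ζ := by
        simp only [ζ, Complex.coe_smul, smul_smul, mul_inv_cancel₀ hz0.ne', one_smul]
      have hζ1 : ‖ζ‖ = 1 := by simp [ζ, norm_smul, hz0.ne']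
      have e : (1 : ℂ) - inner ℂ x z = (1 - inner ℂ x ζ) + ((1 - ‖z‖ : ℝ) : ℂ) * inner ℂ x ζ := by
        nth_rewrite 1 [hzζ]
        rw [inner_smul_right]; push_cast; ring
      have e1 : ‖(1 : ℂ) - inner ℂ x ζ‖ < A * Real.exp (-2 * θ₀) ^ K.1 := by
        rw [← inner_conj_symm, ← map_one (starRingEnd ℂ), ← map_sub, RCLike.norm_conj]
        simpa using hζ
      have e2 : ‖((1 - ‖z‖ : ℝ) : ℂ) * inner ℂ x ζ‖ ≤ 2 * Real.exp (-2 * θ₀) ^ K.1 := by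
        rw [norm_mul, Complex.norm_real, Real.norm_of_nonneg (by linarith)]
        have := norm_inner_le_norm (𝕜 := ℂ) x ζ
        rw [hx, hζ1, one_mul] at this
        have h3 := one_sub_tanh_le (K.1 * θ₀)
        rw [← exp_neg_two_mul_pow] at h3
        calc _ ≤ (1 - ‖z‖) * 1 := by
              apply mul_le_mul_of_nonneg_left this; linarith
          _ ≤ _ := by linarith
      rw [e]
      refine (norm_add_le _ _).trans_lt ?_
      linarith
    refine (measure_mono hsub).trans ((h _ (Q.center_mem _ _) _ (by positivity)).trans ?_)
    refine ENNReal.ofReal_le_ofReal ?_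
    rw [mul_pow, ← pow_mul, ← mul_assoc]
    gcongr
    simp

end SphereDyadicSystem

/-! ### A common tent for two points. -/

/-- With `d = |1 - ⟨z, w⟩|`, the directions of `z` and `w` are at quasi-distance at most `2d`, so a
cube of scale at most of order `d` contains both. That cube may be too small for its tent to reach
down to the radii of `z` and `w`; an ancestor of scale at least `d`, or the root, is large enough
since `1 - |z|` and `1 - |w|` are at most `d`. -/
theorem exists_tent_of_mem_unitBall {n : ℕ} {θ₀ : ℝ} (hn : 1 ≤ n) (hθ : 0 < θ₀)
    (D : DyadicFamily n θ₀) : ∃ C : ℝ, 0 < C ∧ ∀ z ∈ unitBall n, ∀ w ∈ unitBall n,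
      ∃ (ℓ : Fin D.N) (K : (D.system ℓ).Kube), z ∈ (D.system ℓ).tent θ₀ K ∧
        w ∈ (D.system ℓ).tent θ₀ K ∧
        Real.exp (-2 * θ₀) ^ K.1 ≤ C * ‖(1 : ℂ) - inner ℂ w z‖ := by
  obtain ⟨A, hA, happ⟩ := D.approx
  set δ := Real.exp (-2 * θ₀) with hδ
  have hδ0 : 0 < δ := Real.exp_pos _
  have hδ1 : δ < 1 := by rw [hδ, Real.exp_lt_one_iff]; linarith
  refine ⟨3 * A + δ⁻¹, by positivity, fun z hz w hw => ?_⟩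
  have hz1 : ‖z‖ < 1 := by simpa [unitBall] using hz
  have hw1 : ‖w‖ < 1 := by simpa [unitBall] using hw
  set d := ‖(1 : ℂ) - inner ℂ w z‖ with hd
  have hin : ‖inner ℂ w z‖ ≤ ‖w‖ * ‖z‖ := norm_inner_le_norm _ _
  have hdwz : 1 - ‖w‖ * ‖z‖ ≤ d := by
    have := norm_sub_norm_le (1 : ℂ) (inner ℂ w z)
    rw [norm_one] at this
    linarith
  have hdz : 1 - ‖z‖ ≤ d := by nlinarith [norm_nonneg z, norm_nonneg w]
  have hdw : 1 - ‖w‖ ≤ d := by nlinarith [norm_nonneg z, norm_nonneg w]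
  have hd0 : 0 < d := by linarith
  obtain ⟨e, he⟩ := unitSphere_nonempty hn
  have hdir : ∀ v : Cn n, ∃ ζ ∈ unitSphere n, v = ((‖v‖ : ℝ) : ℂ) • ζ ∧
      ∀ Q : Set (Cn n), ζ ∈ Q → v ∈ cone Q := by
    intro v
    by_cases hv : v = 0
    · exact ⟨e, he, by simp [hv], fun Q _ => Or.inl hv⟩
    · refine ⟨_, inv_norm_smul_mem_unitSphere hv, ?_, fun Q h => Or.inr h⟩
      rw [Complex.coe_smul, smul_smul, mul_inv_cancel₀ (norm_ne_zero_iff.2 hv), one_smul]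
  obtain ⟨ζ, hζ, hzζ, hζc⟩ := hdir z
  obtain ⟨ω, hω, hwω, hωc⟩ := hdir w
  have hζ1 : ‖ζ‖ = 1 := by simpa [unitSphere] using hζ
  have hω1 : ‖ω‖ = 1 := by simpa [unitSphere] using hω
  have hball : ∀ v ∈ ({ζ, ω} : Set (Cn n)), v ∈ quasiBall ζ (3 * d) := by
    rintro v (rfl | rfl)
    · refine ⟨hζ, ?_⟩
      simp only [inner_self_eq_norm_sq_to_K, hζ1]
      simp [hd0]
    · refine ⟨hω, ?_⟩
      have e1 : (inner ℂ w z : ℂ) = ((‖w‖ * ‖z‖ : ℝ) : ℂ) * inner ℂ v ζ := by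
        nth_rewrite 1 [hzζ, hwω]
        rw [inner_smul_left, inner_smul_right, Complex.conj_ofReal]; push_cast; ring
      have e2 : (1 : ℂ) - inner ℂ v ζ =
          (1 - inner ℂ w z) - ((1 - ‖w‖ * ‖z‖ : ℝ) : ℂ) * inner ℂ v ζ := by
        rw [e1]; push_cast; ring
      have h3 := norm_inner_le_norm (𝕜 := ℂ) v ζ
      rw [hω1, hζ1, one_mul] at h3
      have h4 : 0 ≤ 1 - ‖w‖ * ‖z‖ := by nlinarith [norm_nonneg z, norm_nonneg w]
      rw [e2]
      refine (norm_sub_le _ _).trans_lt ?_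
      rw [norm_mul, Complex.norm_real, Real.norm_of_nonneg h4, ← hd]
      have : (1 - ‖w‖ * ‖z‖) * ‖(inner ℂ v ζ : ℂ)‖ ≤ (1 - ‖w‖ * ‖z‖) * 1 := by gcongr
      linarith
  have key : ∃ (ℓ : Fin D.N) (k : ℕ) (j : Fin ((D.system ℓ).card k)),
      ζ ∈ (D.system ℓ).cube k j ∧ ω ∈ (D.system ℓ).cube k j ∧ δ ^ k ≤ (3 * A + δ⁻¹) * d := by
    by_cases hr : A * (3 * d) ≤ 1
    · obtain ⟨ℓ, k, j, h1, h2⟩ := happ ζ hζ (3 * d) (by positivity) hr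
      refine ⟨ℓ, k, j, h1 (hball ζ (by simp)), h1 (hball ω (by simp)), h2.trans ?_⟩
      have : 0 < δ⁻¹ * d := by positivity
      linarith
    -- Here the root of any system works; the approximation property is invoked only to know that
    -- there is a system.
    · obtain ⟨ℓ, -⟩ := happ ζ hζ (1 / A) (by positivity) (by rw [mul_one_div_cancel hA.ne'])
      obtain ⟨j, hj⟩ := (D.system ℓ).exists_mem_cube 0 hζ
      refine ⟨ℓ, 0, j, hj, by rw [(D.system ℓ).cube_zero]; exact hω, ?_⟩
      have : 0 < δ⁻¹ * d := by positivity
      rw [pow_zero]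
      linarith
  obtain ⟨ℓ, k, j, hζj, hωj, hk⟩ := key
  -- Climbing one generation from `δ^(k+1) < d` keeps the upper bound because `δ^k < δ⁻¹ d`; this is
  -- the origin of the summand `δ⁻¹`.
  have hanc : ∃ m, m ≤ k ∧ (m = 0 ∨ d ≤ δ ^ m) ∧ δ ^ m ≤ (3 * A + δ⁻¹) * d := by
    clear hζj hωj j
    induction k with
    | zero => exact ⟨0, le_rfl, Or.inl rfl, hk⟩
    | succ k ih =>
      by_cases hdk : d ≤ δ ^ (k + 1)
      · exact ⟨k + 1, le_rfl, Or.inr hdk, hk⟩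
      · obtain ⟨m, hm, h⟩ := ih (by
          rw [pow_succ, not_le] at hdk
          have : δ ^ k ≤ δ⁻¹ * d := by
            rw [le_inv_mul_iff₀ hδ0, mul_comm]; exact hdk.le
          have : 0 < 3 * A * d := by positivity
          linarith)
        exact ⟨m, by omega, h⟩
  obtain ⟨m, hmk, hm, hmd⟩ := hanc
  obtain ⟨i, hi⟩ := (D.system ℓ).exists_mem_cube m hζ
  have hsub := (D.system ℓ).subset_of_mem hmk hi hζj
  have hrad : ∀ v : Cn n, 1 - ‖v‖ ≤ d → Real.tanh (m * θ₀) ≤ ‖v‖ := by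
    intro v hv
    rcases hm with rfl | hm
    · simp
    · rw [hδ, exp_neg_two_mul_pow] at hm
      have := exp_le_one_sub_tanh (s := m * θ₀) (by positivity)
      linarith
  refine ⟨ℓ, ⟨m, i⟩, ?_, ?_, hmd⟩
  · exact ((D.system ℓ).mem_tent_iff hn hδ0 hθ _ _).2 ⟨hz, hrad z hdz, hζc _ hi⟩
  · exact ((D.system ℓ).mem_tent_iff hn hδ0 hθ _ _).2 ⟨hw, hrad w hdw, hωc _ (hsub hωj)⟩

/-! ### Sparse operators on abstract tent trees. -/

/-- A tree of tents in a measure space, whose tents have thin tops: the tents `d` generations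
below a given one cover at most a fraction `M p⁸ᵈ` of it. -/
structure TentTree {α : Type*} [MeasurableSpace α] (μ : Measure α) (p M : ℝ≥0∞) where
  /-- the number of tents of each generation -/
  card : ℕ → ℕ
  /-- the tents -/
  tent : ((k : ℕ) × Fin (card k)) → Set α
  /-- the size of the tents -/
  size : ((k : ℕ) × Fin (card k)) → ℝ≥0∞
  size_ne_zero : ∀ K, size K ≠ 0
  size_ne_top : ∀ K, size K ≠ ⊤
  measurableSet_tent : ∀ K, MeasurableSet (tent K)
  nested : ∀ J K, K.1 ≤ J.1 → ∀ z ∈ tent J, z ∈ tent K → tent J ⊆ tent K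
  eq_of_mem : ∀ k i j, ∀ z ∈ tent ⟨k, i⟩, z ∈ tent ⟨k, j⟩ → i = j
  measure_inter_le : ∀ K d, μ (tent K ∩ ⋃ j, tent ⟨K.1 + d, j⟩) ≤ M * p ^ (8 * d) * μ (tent K)
  measure_le : ∀ K, μ (tent K) ≤ M * size K

theorem sq_tsum_mul_le {ι : Type*} (a b : ι → ℝ≥0∞) :
    (∑' i, a i * b i) ^ 2 ≤ (∑' i, a i ^ 2) * ∑' i, b i ^ 2 := by
  let _ : MeasurableSpace ι := ⊤
  have h := ENNReal.lintegral_mul_le_Lp_mul_Lq (Measure.count : Measure ι)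
    (Real.HolderConjugate.two_two) (f := a) (g := b) measurable_from_top.aemeasurable
    measurable_from_top.aemeasurable
  simp only [Pi.mul_apply, lintegral_count, ENNReal.rpow_two] at h
  have h2 := pow_le_pow_left₀ (zero_le) h 2
  refine h2.trans_eq ?_
  rw [mul_pow, ← ENNReal.rpow_two, ← ENNReal.rpow_two, ← ENNReal.rpow_mul, ← ENNReal.rpow_mul]
  norm_num

/-- Replaces Cauchy–Schwarz between an `L⁴` bound and a small set: `a` is later chosen as the square
root of the relative size of that set. -/
theorem sq_le_mul_pow_four_add_inv (x : ℝ≥0∞) {a : ℝ≥0∞} : x ^ 2 ≤ a * x ^ 4 + a⁻¹ := by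
  rcases le_or_gt (x ^ 2) a⁻¹ with h | h
  · exact h.trans le_add_self
  · refine le_trans ?_ le_self_add
    have h1 : 1 ≤ a * x ^ 2 := by
      rw [← ENNReal.inv_le_iff_le_mul] 
      · exact h.le
      · intro hx; simp_all; exact h.ne'
      · rintro rfl hx; simp_all
    calc x ^ 2 = 1 * x ^ 2 := (one_mul _).symm
      _ ≤ a * x ^ 2 * x ^ 2 := by gcongr
      _ = a * x ^ 4 := by ring

theorem tsum_ite_le_eq (k : ℕ) (φ : ℕ → ℝ≥0∞) :
    ∑' m, (if k ≤ m then φ m else 0) = ∑' d, φ (k + d) := by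
  rw [← (add_right_injective k).tsum_eq]
  · simp
  · intro m hm
    simp only [Function.mem_support, ne_eq, ite_eq_right_iff, Classical.not_imp] at hm
    exact ⟨m - k, by simp [hm.1]⟩

namespace TentTree

variable {α : Type*} [MeasurableSpace α] {μ : Measure α} {p M : ℝ≥0∞} (T : TentTree μ p M)

/-- The indices of the tents. -/
abbrev Index : Type := (k : ℕ) × Fin (T.card k)

/-- The union of the tents of one generation. -/
def layer (m : ℕ) : Set α := ⋃ j, T.tent ⟨m, j⟩

theorem measurableSet_layer (m : ℕ) : MeasurableSet (T.layer m) :=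
  MeasurableSet.iUnion fun _ => T.measurableSet_tent _

theorem sum_indicator_tent (m : ℕ) (c : ℝ≥0∞) (z : α) :
    ∑ j, (T.tent ⟨m, j⟩).indicator (fun _ => c) z = (T.layer m).indicator (fun _ => c) z := by
  by_cases hz : z ∈ T.layer m
  · obtain ⟨j, hj⟩ := Set.mem_iUnion.1 hz
    rw [Set.indicator_of_mem hz, Finset.sum_eq_single j]
    · simp [hj]
    · intro i _ hij
      exact Set.indicator_of_notMem (fun hi => hij (T.eq_of_mem m i j z hi hj)) _
    · simp
  · rw [Set.indicator_of_notMem hz]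
    refine Finset.sum_eq_zero fun j _ => Set.indicator_of_notMem (fun h => hz ?_) _
    exact Set.mem_iUnion.2 ⟨j, h⟩

theorem measure_inter_layer_le (K : T.Index) (d : ℕ) :
    μ (T.tent K ∩ T.layer (K.1 + d)) ≤ M * p ^ (8 * d) * μ (T.tent K) :=
  T.measure_inter_le K d

open Classical in
-- Carleson packing: tents of one generation are disjoint, so generation `d` below `K` contributes
-- at most `M p^(8d) μ(K)`, a geometric series.
theorem tsum_descendants_le (K : T.Index) :
    ∑' J : T.Index, (if K.1 ≤ J.1 ∧ T.tent J ⊆ T.tent K then μ (T.tent J) else 0) ≤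
      M * (1 - p ^ 8)⁻¹ * μ (T.tent K) := by
  rw [ENNReal.tsum_sigma']
  have h1 : ∀ m, ∑' j, (if K.1 ≤ m ∧ T.tent ⟨m, j⟩ ⊆ T.tent K then μ (T.tent ⟨m, j⟩) else 0) ≤
      if K.1 ≤ m then μ (T.tent K ∩ T.layer m) else 0 := by
    intro m
    split_ifs with hm
    · calc _ ≤ ∑' j, μ (T.tent K ∩ T.tent ⟨m, j⟩) := by
            refine ENNReal.tsum_le_tsum fun j => ?_
            split_ifs with h
            · rw [Set.inter_eq_self_of_subset_right h.2]
            · exact zero_le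
        _ = _ := by
          rw [layer, Set.inter_iUnion, measure_iUnion]
          · intro i j hij
            refine Set.disjoint_left.2 fun z hi hj => hij ?_
            exact T.eq_of_mem m i j z hi.2 hj.2
          · exact fun j => (T.measurableSet_tent K).inter (T.measurableSet_tent _)
    · simp [hm]
  refine (ENNReal.tsum_le_tsum h1).trans ?_
  rw [tsum_ite_le_eq]
  refine (ENNReal.tsum_le_tsum fun d => T.measure_inter_layer_le K d).trans_eq ?_
  rw [ENNReal.tsum_mul_right, ENNReal.tsum_mul_left]
  simp_rw [pow_mul]
  rw [ENNReal.tsum_geometric]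

/-- The maximal elements of a family of tents. -/
def maximals (H : Set T.Index) : Set T.Index :=
  {K | K ∈ H ∧ ∀ J ∈ H, J.1 < K.1 → ¬ T.tent K ⊆ T.tent J}

theorem exists_maximal (H : Set T.Index) (K : T.Index) (hK : K ∈ H) :
    ∃ J ∈ T.maximals H, J.1 ≤ K.1 ∧ T.tent K ⊆ T.tent J := by
  induction hk : K.1 using Nat.strong_induction_on generalizing K with
  | _ k ih =>
    by_cases h : K ∈ T.maximals H
    · exact ⟨K, h, hk.le, subset_rfl⟩
    · simp only [maximals, Set.mem_ofPred_eq, hK, true_and, not_forall, not_not] at h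
      obtain ⟨L, hL, hLK, hsub⟩ := h
      obtain ⟨J, hJ, h1, h2⟩ := ih L.1 (hk ▸ hLK) L hL rfl
      exact ⟨J, hJ, by omega, hsub.trans h2⟩

theorem pairwise_disjoint_maximals (H : Set T.Index) :
    Pairwise (Function.onFun Disjoint fun K : T.maximals H => T.tent K) := by
  rintro ⟨K, hK⟩ ⟨J, hJ⟩ hne
  refine Set.disjoint_left.2 fun z hz hz' => hne ?_
  rcases lt_trichotomy K.1 J.1 with h | h | h
  · exact absurd (T.nested J K h.le z hz' hz) (hJ.2 K hK.1 h)
  · obtain ⟨k, i⟩ := K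
    obtain ⟨l, j⟩ := J
    obtain rfl : k = l := h
    obtain rfl := T.eq_of_mem k i j z hz hz'
    rfl
  · exact absurd (T.nested K J h.le z hz hz') (hK.2 J hJ.1 h)

open Classical in
/-- The weak type estimate, together with the Carleson packing property of the tents. -/
theorem mul_tsum_measure_le (H : Set T.Index) (F : α → ℝ≥0∞) (a : ℝ≥0∞)
    (hH : ∀ K ∈ H, a * T.size K ≤ ∫⁻ z in T.tent K, F z ∂μ) :
    a * ∑' K : T.Index, (if K ∈ H then μ (T.tent K) else 0) ≤
      M ^ 2 * (1 - p ^ 8)⁻¹ * ∫⁻ z, F z ∂μ := by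
  set C := M * (1 - p ^ 8)⁻¹ with hC
  -- Each tent of `H` lies below a maximal one, and packing charges all of them to the maximal
  -- tents, which are disjoint.
  have h1 : ∑' K : T.Index, (if K ∈ H then μ (T.tent K) else 0) ≤
      ∑' J : T.maximals H, C * μ (T.tent J) := by
    calc _ ≤ ∑' K : T.Index, ∑' J : T.maximals H,
          (if J.1.1 ≤ K.1 ∧ T.tent K ⊆ T.tent J then μ (T.tent K) else 0) := by
          refine ENNReal.tsum_le_tsum fun K => ?_
          split_ifs with h
          · obtain ⟨J, hJ, h1, h2⟩ := T.exists_maximal H K h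
            refine le_trans ?_ (ENNReal.le_tsum ⟨J, hJ⟩)
            simp [h1, h2]
          · exact zero_le
      _ = ∑' J : T.maximals H, ∑' K : T.Index,
          (if J.1.1 ≤ K.1 ∧ T.tent K ⊆ T.tent J then μ (T.tent K) else 0) := ENNReal.tsum_comm
      _ ≤ _ := ENNReal.tsum_le_tsum fun J => T.tsum_descendants_le J
  calc _ ≤ a * ∑' J : T.maximals H, C * μ (T.tent J) := by gcongr
    _ ≤ a * ∑' J : T.maximals H, C * (M * T.size J) := by
      gcongr; exact T.measure_le _
    _ = C * M * ∑' J : T.maximals H, a * T.size J := by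
      simp_rw [ENNReal.tsum_mul_left]; ring
    _ ≤ C * M * ∑' J : T.maximals H, ∫⁻ z in T.tent J, F z ∂μ := by
      gcongr with J; exact hH _ J.2.1
    _ = C * M * ∫⁻ z in ⋃ J : T.maximals H, T.tent J, F z ∂μ := by
      rw [lintegral_iUnion (fun J => T.measurableSet_tent _) (T.pairwise_disjoint_maximals H)]
    _ ≤ C * M * ∫⁻ z, F z ∂μ := by gcongr; exact Measure.restrict_le_self
    _ = _ := by rw [hC]; ring

/-- The weight `z ↦ ∑ p⁻²ᵐ`, where `m` runs through the generations of the tents containing `z`. -/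
noncomputable def weight (z : α) : ℝ≥0∞ :=
  ∑' m, (T.layer m).indicator (fun _ => (p⁻¹) ^ (2 * m)) z

theorem measurable_weight : Measurable T.weight :=
  Measurable.tsum fun m => measurable_const.indicator (T.measurableSet_layer m)

theorem tsum_indicator_eq_weight (z : α) :
    ∑' K : T.Index, (T.tent K).indicator (fun _ => (p⁻¹) ^ (2 * K.1)) z = T.weight z := by
  rw [ENNReal.tsum_sigma', weight]
  refine tsum_congr fun m => ?_
  rw [tsum_fintype]
  exact T.sum_indicator_tent m ((p⁻¹) ^ (2 * m)) z

/-- On `K` the weight exceeds the order of `p^(-2k)` only in deeper layers. These are so thin that,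
even against `B²`, the average of the weight stays of that order. -/
theorem exists_lintegral_weight_le (hp : p ≠ 0) (hp1 : p < 1) (hM : M ≠ ⊤) (M' : ℝ≥0∞)
    (hM' : M' ≠ ⊤) : ∃ C : ℝ≥0∞, C ≠ ⊤ ∧ ∀ T : TentTree μ p M, ∀ K : T.Index, ∀ B : α → ℝ≥0∞,
      AEMeasurable B μ → ∫⁻ z in T.tent K, B z ^ 4 ∂μ ≤ M' * μ (T.tent K) →
      ∫⁻ z in T.tent K, T.weight z * B z ^ 2 ∂μ ≤ C * (p⁻¹) ^ (2 * K.1) * μ (T.tent K) := by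
  have hpt : p ≠ ⊤ := (hp1.trans ENNReal.one_lt_top).ne
  have hgeom : (1 - p ^ 2)⁻¹ ≠ ⊤ := by
    rw [ENNReal.inv_ne_top]
    exact (tsub_pos_of_lt (pow_lt_one₀ (zero_le) hp1 (by simp))).ne'
  refine ⟨(M' + M) * (1 - p ^ 2)⁻¹ + (M' + 1) * (1 - p ^ 2)⁻¹, ?_, fun T K B hB hB4 => ?_⟩
  · exact ENNReal.add_ne_top.2 ⟨ENNReal.mul_ne_top (ENNReal.add_ne_top.2 ⟨hM', hM⟩) hgeom,
      ENNReal.mul_ne_top (ENNReal.add_ne_top.2 ⟨hM', by simp⟩) hgeom⟩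
  have hBr : AEMeasurable B (μ.restrict (T.tent K)) := hB.restrict
  set A := μ (T.tent K) with hA
  have hsplit : ∀ m, ∫⁻ z in T.tent K, (T.layer m).indicator (fun _ => (p⁻¹) ^ (2 * m)) z *
      B z ^ 2 ∂μ = (p⁻¹) ^ (2 * m) * ∫⁻ z in T.layer m ∩ T.tent K, B z ^ 2 ∂μ := by
    intro m
    rw [← Measure.restrict_restrict (T.measurableSet_layer m), ← lintegral_const_mul'',
      ← lintegral_indicator (T.measurableSet_layer m)]
    · refine lintegral_congr fun z => ?_
      by_cases hz : z ∈ T.layer m <;> simp [hz]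
    · exact (hBr.restrict).pow_const 2
  have hcoarse : ∫⁻ z in T.tent K, B z ^ 2 ∂μ ≤ (M' + 1) * A := by
    calc _ ≤ ∫⁻ z in T.tent K, (B z ^ 4 + 1) ∂μ := by
          refine lintegral_mono fun z => ?_
          simpa using sq_le_mul_pow_four_add_inv (B z) (a := 1)
      _ = ∫⁻ z in T.tent K, B z ^ 4 ∂μ + A := by
          rw [lintegral_add_right _ measurable_const]; simp [hA]
      _ ≤ _ := by rw [add_mul, one_mul]; gcongr
  -- The layer occupies a fraction `p^(8d)`, up to `M`; passing from `L⁴` to `L²` leaves its square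
  -- root `p^(4d)`, and the weight costs `p^(-2d)`. The factor `p^(2d)` that remains is summable.
  have hfine : ∀ d, (p⁻¹) ^ (2 * (K.1 + d)) * ∫⁻ z in T.layer (K.1 + d) ∩ T.tent K, B z ^ 2 ∂μ ≤
      (p⁻¹) ^ (2 * K.1) * ((M' + M) * A) * (p ^ 2) ^ d := by
    intro d
    have h1 : ∫⁻ z in T.layer (K.1 + d) ∩ T.tent K, B z ^ 2 ∂μ ≤
        p ^ (4 * d) * ((M' + M) * A) := by
      calc _ ≤ ∫⁻ z in T.layer (K.1 + d) ∩ T.tent K,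
            (p ^ (4 * d) * B z ^ 4 + (p ^ (4 * d))⁻¹) ∂μ :=
            lintegral_mono fun z => sq_le_mul_pow_four_add_inv (B z)
        _ = p ^ (4 * d) * ∫⁻ z in T.layer (K.1 + d) ∩ T.tent K, B z ^ 4 ∂μ +
            (p ^ (4 * d))⁻¹ * μ (T.layer (K.1 + d) ∩ T.tent K) := by
            rw [lintegral_add_right _ measurable_const, lintegral_const_mul'']
            · simp
            · exact (hB.restrict).pow_const 4
        _ ≤ p ^ (4 * d) * (M' * A) + (p ^ (4 * d))⁻¹ * (M * p ^ (8 * d) * A) := by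
            gcongr
            · exact (lintegral_mono_set Set.inter_subset_right).trans hB4
            · rw [Set.inter_comm]; exact T.measure_inter_layer_le K d
        _ = _ := by
            have : (p ^ (4 * d))⁻¹ * p ^ (8 * d) = p ^ (4 * d) := by
              rw [show 8 * d = 4 * d + 4 * d by ring, pow_add, ← mul_assoc,
                ENNReal.inv_mul_cancel (pow_ne_zero _ hp) (ENNReal.pow_ne_top hpt), one_mul]
            calc _ = p ^ (4 * d) * (M' * A) + ((p ^ (4 * d))⁻¹ * p ^ (8 * d)) * (M * A) := by ring
              _ = _ := by rw [this]; ring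
    have h2 : (p⁻¹) ^ (2 * d) * p ^ (4 * d) = (p ^ 2) ^ d := by
      rw [show 4 * d = 2 * d + 2 * d by ring, pow_add, ← mul_assoc, ← mul_pow,
        ENNReal.inv_mul_cancel hp hpt, one_pow, one_mul, pow_mul]
    calc _ ≤ (p⁻¹) ^ (2 * (K.1 + d)) * (p ^ (4 * d) * ((M' + M) * A)) := by gcongr
      _ = (p⁻¹) ^ (2 * K.1) * ((M' + M) * A) * ((p⁻¹) ^ (2 * d) * p ^ (4 * d)) := by
        rw [mul_add, pow_add]; ring
      _ = _ := by rw [h2]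
  have hlow : ∑' m, (if m < K.1 then (p⁻¹) ^ (2 * m) else 0) ≤
      (p⁻¹) ^ (2 * K.1) * (1 - p ^ 2)⁻¹ := by
    have e : ∑' m, (if m < K.1 then (p⁻¹) ^ (2 * m) else 0) =
        ∑ m ∈ Finset.range K.1, (p⁻¹) ^ (2 * m) := by
      rw [tsum_eq_sum (s := Finset.range K.1)]
      · exact Finset.sum_congr rfl fun m hm => by simp [Finset.mem_range.1 hm]
      · intro m hm; simp at hm; simp [hm]
    rw [e, ← Finset.sum_range_reflect, ← ENNReal.tsum_geometric, ← ENNReal.tsum_mul_left]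
    refine le_trans (Finset.sum_le_sum fun m hm => ?_) (ENNReal.sum_le_tsum (Finset.range K.1))
    have hm' := Finset.mem_range.1 hm
    have hq1 : 1 ≤ p⁻¹ := ENNReal.one_le_inv.2 hp1.le
    calc (p⁻¹) ^ (2 * (K.1 - 1 - m)) ≤ (p⁻¹) ^ (2 * (K.1 - m)) := by
          exact pow_le_pow_right₀ hq1 (by omega)
      _ = (p⁻¹) ^ (2 * (K.1 - m)) * ((p⁻¹) ^ (2 * m) * p ^ (2 * m)) := by
          rw [← mul_pow, ENNReal.inv_mul_cancel hp hpt, one_pow, mul_one]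
      _ = _ := by
          rw [← mul_assoc, ← pow_add, ← pow_mul]; congr 2; omega
  calc ∫⁻ z in T.tent K, T.weight z * B z ^ 2 ∂μ
      = ∑' m, ∫⁻ z in T.tent K, (T.layer m).indicator (fun _ => (p⁻¹) ^ (2 * m)) z *
          B z ^ 2 ∂μ := by
        simp_rw [weight, ← ENNReal.tsum_mul_right]
        refine lintegral_tsum fun m => ?_
        exact ((measurable_const.indicator (T.measurableSet_layer m)).aemeasurable).mul
          (hBr.pow_const 2)
    _ = ∑' m, (p⁻¹) ^ (2 * m) * ∫⁻ z in T.layer m ∩ T.tent K, B z ^ 2 ∂μ := tsum_congr hsplit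
    _ ≤ ∑' m, ((if K.1 ≤ m then (p⁻¹) ^ (2 * m) * ∫⁻ z in T.layer m ∩ T.tent K, B z ^ 2 ∂μ else 0)
          + (if m < K.1 then (p⁻¹) ^ (2 * m) else 0) * ((M' + 1) * A)) := by
        refine ENNReal.tsum_le_tsum fun m => ?_
        rcases le_or_gt K.1 m with h | h
        · simp [h]
        · simp only [h, if_true, not_le.2 h, if_false, zero_add]
          gcongr
          exact (lintegral_mono_set Set.inter_subset_right).trans hcoarse
    _ ≤ (p⁻¹) ^ (2 * K.1) * ((M' + M) * A) * (1 - p ^ 2)⁻¹ +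
          (p⁻¹) ^ (2 * K.1) * (1 - p ^ 2)⁻¹ * ((M' + 1) * A) := by
        rw [ENNReal.tsum_add, tsum_ite_le_eq, ENNReal.tsum_mul_right]
        gcongr
        · refine (ENNReal.tsum_le_tsum hfine).trans_eq ?_
          rw [ENNReal.tsum_mul_left, ENNReal.tsum_geometric]
    _ = _ := by ring

open Classical in
-- Sorting the tents by the ratio of `∫_K F` to the size into levels `16^(-m)`, the bound on `y²`
-- gains `64^(-m)` while the packed weak type estimate loses `16^(m+1)`.
theorem exists_tsum_measure_mul_sq_le (hp1 : p < 1) (hM : M ≠ ⊤) (A : ℝ≥0∞)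
    (hA : A ≠ ⊤) : ∃ C : ℝ≥0∞, C ≠ ⊤ ∧ ∀ T : TentTree μ p M, ∀ F : α → ℝ≥0∞,
      ∀ y : T.Index → ℝ≥0∞,
      (∀ K, ∀ m : ℕ, ∫⁻ z in T.tent K, F z ∂μ ≤ (16⁻¹) ^ m * T.size K → y K ≤ A * (8⁻¹) ^ m) →
      ∑' K : T.Index, (if ∫⁻ z in T.tent K, F z ∂μ ≤ T.size K then μ (T.tent K) * y K ^ 2 else 0)
        ≤ C * ∫⁻ z, F z ∂μ := by
  set C₁ := M ^ 2 * (1 - p ^ 8)⁻¹ with hC₁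
  have hC₁t : C₁ ≠ ⊤ := by
    refine ENNReal.mul_ne_top (ENNReal.pow_ne_top hM) ?_
    rw [ENNReal.inv_ne_top]
    exact (tsub_pos_of_lt (pow_lt_one₀ (zero_le) hp1 (by simp))).ne'
  refine ⟨A ^ 2 * (16 * C₁) * (1 - 4⁻¹)⁻¹, ?_, fun T F y hy => ?_⟩
  · refine ENNReal.mul_ne_top (ENNReal.mul_ne_top (ENNReal.pow_ne_top hA)
      (ENNReal.mul_ne_top (by simp) hC₁t)) ?_
    rw [ENNReal.inv_ne_top]
    exact (tsub_pos_of_lt (ENNReal.inv_lt_one.2 (by norm_num))).ne'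
  set H : ℕ → Set T.Index := fun m =>
    {K | (16⁻¹) ^ (m + 1) * T.size K ≤ ∫⁻ z in T.tent K, F z ∂μ} with hH
  have hpt : ∀ K : T.Index,
      (if ∫⁻ z in T.tent K, F z ∂μ ≤ T.size K then μ (T.tent K) * y K ^ 2 else 0) ≤
        ∑' m, A ^ 2 * (64⁻¹) ^ m * (if K ∈ H m then μ (T.tent K) else 0) := by
    intro K
    split_ifs with hK
    · by_cases hex : ∃ m, K ∈ H m
      · have hmin := Nat.find_spec hex
        set m := Nat.find hex with hm
        refine le_trans ?_ (ENNReal.le_tsum m)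
        rw [if_pos hmin]
        have hle : ∫⁻ z in T.tent K, F z ∂μ ≤ (16⁻¹) ^ m * T.size K := by
          rcases Nat.eq_zero_or_pos m with h0 | hpos
          · simpa [h0] using hK
          · have := Nat.find_min hex (m := m - 1) (by omega)
            simp only [hH, Set.mem_ofPred_eq, not_le, Nat.sub_add_cancel hpos] at this
            exact this.le
        have := hy K m hle
        calc μ (T.tent K) * y K ^ 2 ≤ μ (T.tent K) * (A * (8⁻¹) ^ m) ^ 2 := by gcongr
          _ = _ := by
            rw [mul_pow, ← pow_mul, mul_comm m 2, pow_mul, ← ENNReal.inv_pow]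
            norm_num
            ring
      -- A tent that belongs to no level satisfies the hypothesis on `y` for every `m`, which forces
      -- `y K = 0`.
      · have hlt : ∀ m : ℕ, y K ≤ A * (8⁻¹) ^ m := by
          intro m
          refine hy K m ?_
          rcases Nat.eq_zero_or_pos m with h0 | hpos
          · simpa [h0] using hK
          · have := not_exists.1 hex (m - 1)
            simp only [hH, Set.mem_ofPred_eq, not_le, Nat.sub_add_cancel hpos] at this
            exact this.le
        have hlim : Filter.Tendsto (fun m : ℕ => A * (8⁻¹ : ℝ≥0∞) ^ m) Filter.atTop
            (nhds (A * 0)) :=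
          ENNReal.Tendsto.const_mul (ENNReal.tendsto_pow_atTop_nhds_zero_of_lt_one
            (ENNReal.inv_lt_one.2 (by norm_num))) (Or.inr hA)
        have h0 : y K ≤ A * 0 := ge_of_tendsto' hlim hlt
        have h0 : y K = 0 := by simpa using h0
        simp [h0]
    · exact zero_le
  refine (ENNReal.tsum_le_tsum hpt).trans ?_
  rw [ENNReal.tsum_comm]
  have hm : ∀ m, ∑' K : T.Index, A ^ 2 * (64⁻¹) ^ m * (if K ∈ H m then μ (T.tent K) else 0) ≤
      A ^ 2 * (16 * C₁) * (∫⁻ z, F z ∂μ) * (4⁻¹) ^ m := by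
    intro m
    rw [ENNReal.tsum_mul_left]
    have h := T.mul_tsum_measure_le (H m) F _ (fun K hK => hK)
    rw [← hC₁] at h
    have e : (64⁻¹ : ℝ≥0∞) ^ m = 16 * (4⁻¹) ^ m * (16⁻¹) ^ (m + 1) := by
      have h64 : (64⁻¹ : ℝ≥0∞) = 4⁻¹ * 16⁻¹ := by
        rw [← ENNReal.mul_inv (by simp) (by simp)]; norm_num
      have h16 : (16 : ℝ≥0∞) * 16⁻¹ = 1 := ENNReal.mul_inv_cancel (by simp) (by simp)
      rw [h64, mul_pow, pow_succ]
      calc _ = (16 * 16⁻¹) * ((4⁻¹ : ℝ≥0∞) ^ m * (16⁻¹) ^ m) := by rw [h16, one_mul]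
        _ = _ := by ring
    calc _ = A ^ 2 * (16 * (4⁻¹) ^ m) * ((16⁻¹) ^ (m + 1) *
          ∑' K : T.Index, (if K ∈ H m then μ (T.tent K) else 0)) := by rw [e]; ring
      _ ≤ A ^ 2 * (16 * (4⁻¹) ^ m) * (C₁ * ∫⁻ z, F z ∂μ) := by
        refine mul_le_mul_right ?_ _
        convert h
      _ = _ := by ring
  refine (ENNReal.tsum_le_tsum hm).trans_eq ?_
  rw [ENNReal.tsum_mul_left, ENNReal.tsum_geometric]
  ring

open Classical in
/-- The weak type estimate for the sparse operator `∑ 1_T B_T y_T` of a tent tree. -/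
theorem exists_measure_tsum_indicator_le (hp : p ≠ 0) (hp1 : p < 1) (hM : M ≠ ⊤) (A M' : ℝ≥0∞)
    (hA : A ≠ ⊤) (hM' : M' ≠ ⊤) (κ : ℝ≥0∞) (hκ : κ ≠ 0) (hκ' : κ ≠ ⊤) :
    ∃ C : ℝ≥0∞, C ≠ ⊤ ∧ ∀ T : TentTree μ p M, ∀ F : α → ℝ≥0∞, ∀ y : T.Index → ℝ≥0∞,
      ∀ B : T.Index → α → ℝ≥0∞, (∀ K, AEMeasurable (B K) μ) →
      (∀ K, ∫⁻ z in T.tent K, B K z ^ 4 ∂μ ≤ M' * μ (T.tent K)) →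
      (∀ K, ∀ m : ℕ, ∫⁻ z in T.tent K, F z ∂μ ≤ (16⁻¹) ^ m * T.size K → y K ≤ A * (8⁻¹) ^ m) →
      μ {z | κ < ∑' K, (T.tent K).indicator (fun z => B K z * y K) z} ≤ C * ∫⁻ z, F z ∂μ := by
  obtain ⟨C₂, hC₂, hweight⟩ := exists_lintegral_weight_le (μ := μ) hp hp1 hM M' hM'
  obtain ⟨C₃, hC₃, hsum⟩ := exists_tsum_measure_mul_sq_le (μ := μ) hp1 hM A hA
  have hpt : p ≠ ⊤ := (hp1.trans ENNReal.one_lt_top).ne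
  have hC₁t : M ^ 2 * (1 - p ^ 8)⁻¹ ≠ ⊤ := by
    refine ENNReal.mul_ne_top (ENNReal.pow_ne_top hM) ?_
    rw [ENNReal.inv_ne_top]
    exact (tsub_pos_of_lt (pow_lt_one₀ (zero_le) hp1 (by simp))).ne'
  refine ⟨M ^ 2 * (1 - p ^ 8)⁻¹ + C₂ * C₃ / κ ^ 2, ?_, fun T F y B hB hB4 hy => ?_⟩
  · exact ENNReal.add_ne_top.2 ⟨hC₁t, ENNReal.div_ne_top (ENNReal.mul_ne_top hC₂ hC₃)
      (pow_ne_zero _ hκ)⟩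
  -- Outside the union of the tents not in `G`, the full sum equals its part `S` over `G`, to which
  -- Chebyshev's inequality in `L²` applies.
  set G : Set T.Index := {K | ∫⁻ z in T.tent K, F z ∂μ ≤ T.size K} with hG
  set S : α → ℝ≥0∞ := fun z =>
    ∑' K, if K ∈ G then (T.tent K).indicator (fun z => B K z * y K) z else 0 with hS
  have hind : ∀ K, AEMeasurable ((T.tent K).indicator (fun z => B K z * y K)) μ := fun K =>
    ((hB K).mul_const _).indicator (T.measurableSet_tent K)
  have hSm : AEMeasurable S μ := by
    refine AEMeasurable.tsum fun K => ?_
    by_cases h : K ∈ G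
    · simpa [h] using hind K
    · simp [h]
  have hsub : {z | κ < ∑' K, (T.tent K).indicator (fun z => B K z * y K) z} ⊆
      (⋃ K ∈ Gᶜ, T.tent K) ∪ {z | κ ^ 2 ≤ S z ^ 2} := by
    intro z hz
    by_cases h : z ∈ ⋃ K ∈ Gᶜ, T.tent K
    · exact Or.inl h
    · right
      have : S z = ∑' K, (T.tent K).indicator (fun z => B K z * y K) z := by
        refine tsum_congr fun K => ?_
        split_ifs with hK
        · rfl
        · rw [Set.indicator_of_notMem]
          exact fun hz' => h (Set.mem_biUnion hK hz')
      have hz : κ < S z := this ▸ hz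
      exact pow_le_pow_left₀ (zero_le) hz.le 2
  have hbad : μ (⋃ K ∈ Gᶜ, T.tent K) ≤ M ^ 2 * (1 - p ^ 8)⁻¹ * ∫⁻ z, F z ∂μ := by
    have h := T.mul_tsum_measure_le Gᶜ F 1 (fun K hK => by
      rw [one_mul]
      have hK : ¬ ∫⁻ z in T.tent K, F z ∂μ ≤ T.size K := hK
      exact (not_le.1 hK).le)
    rw [one_mul] at h
    refine le_trans ?_ h
    refine (measure_biUnion_le μ (Set.to_countable _) _).trans_eq ?_
    rw [tsum_subtype Gᶜ (fun K => μ (T.tent K))]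
    exact tsum_congr fun K => by simp [Set.indicator_apply]
  -- Cauchy–Schwarz after inserting `p^(-k) p^k`: the first factor sums to the weight, and `p^(2k)`
  -- in the second cancels the growth allowed by `exists_lintegral_weight_le`.
  have hsq : ∀ z, S z ^ 2 ≤ ∑' K, if K ∈ G then
      (T.tent K).indicator (fun z => p ^ (2 * K.1) * y K ^ 2 * (T.weight z * B K z ^ 2)) z
      else 0 := by
    intro z
    have e : S z = ∑' K : T.Index, (T.tent K).indicator (fun _ => (p⁻¹) ^ K.1) z *
        (if K ∈ G then (T.tent K).indicator (fun z => p ^ K.1 * (B K z * y K)) z else 0) := by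
      refine tsum_congr fun K => ?_
      split_ifs with hK
      · by_cases hz : z ∈ T.tent K
        · simp only [hz, Set.indicator_of_mem]
          rw [← mul_assoc, ← mul_pow, ENNReal.inv_mul_cancel hp hpt, one_pow, one_mul]
        · simp [hz]
      · simp
    rw [e]
    refine (sq_tsum_mul_le _ _).trans_eq ?_
    have e2 : ∑' K : T.Index, (T.tent K).indicator (fun _ => (p⁻¹) ^ K.1) z ^ 2 = T.weight z := by
      rw [← T.tsum_indicator_eq_weight]
      refine tsum_congr fun K => ?_
      by_cases hz : z ∈ T.tent K
      · simp only [hz, Set.indicator_of_mem]; rw [← pow_mul, mul_comm]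
      · simp [hz]
    rw [e2, ← ENNReal.tsum_mul_left]
    refine tsum_congr fun K => ?_
    split_ifs with hK
    · by_cases hz : z ∈ T.tent K
      · simp only [hz, Set.indicator_of_mem]; ring
      · simp [hz]
    · simp
  have hint : ∫⁻ z, S z ^ 2 ∂μ ≤ C₂ * C₃ * ∫⁻ z, F z ∂μ := by
    calc _ ≤ ∫⁻ z, ∑' K, (if K ∈ G then (T.tent K).indicator
            (fun z => p ^ (2 * K.1) * y K ^ 2 * (T.weight z * B K z ^ 2)) z else 0) ∂μ :=
          lintegral_mono hsq
      _ = ∑' K, ∫⁻ z, (if K ∈ G then (T.tent K).indicator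
            (fun z => p ^ (2 * K.1) * y K ^ 2 * (T.weight z * B K z ^ 2)) z else 0) ∂μ := by
          refine lintegral_tsum fun K => ?_
          by_cases h : K ∈ G
          · simp only [h, if_true]
            exact ((T.measurable_weight.aemeasurable.mul ((hB K).pow_const 2)).const_mul
              _).indicator (T.measurableSet_tent K)
          · simp [h]
      _ ≤ ∑' K, C₂ * (if ∫⁻ z in T.tent K, F z ∂μ ≤ T.size K then
            μ (T.tent K) * y K ^ 2 else 0) := by
          refine ENNReal.tsum_le_tsum fun K => ?_
          by_cases h : K ∈ G
          · have h' : ∫⁻ z in T.tent K, F z ∂μ ≤ T.size K := h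
            simp only [h, h', if_true]
            rw [lintegral_indicator (T.measurableSet_tent K), lintegral_const_mul'']
            · calc _ ≤ p ^ (2 * K.1) * y K ^ 2 * (C₂ * (p⁻¹) ^ (2 * K.1) * μ (T.tent K)) := by
                    gcongr
                    exact hweight T K (B K) (hB K) (hB4 K)
                _ = ((p⁻¹) ^ (2 * K.1) * p ^ (2 * K.1)) * (C₂ * (μ (T.tent K) * y K ^ 2)) := by
                    ring
                _ = _ := by
                    rw [← mul_pow, ENNReal.inv_mul_cancel hp hpt, one_pow, one_mul]
            · exact (T.measurable_weight.aemeasurable.mul ((hB K).pow_const 2)).restrict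
          · simp [h]
      _ ≤ _ := by
          rw [ENNReal.tsum_mul_left, mul_assoc]
          gcongr
          exact hsum T F y hy
  refine (measure_mono hsub).trans ((measure_union_le _ _).trans ?_)
  rw [add_mul]
  refine add_le_add hbad ?_
  have := meas_ge_le_lintegral_div (hSm.pow_const 2) (pow_ne_zero 2 hκ) (ENNReal.pow_ne_top hκ')
  refine this.trans ?_
  rw [ENNReal.div_eq_inv_mul, ENNReal.div_eq_inv_mul, mul_assoc]
  gcongr

end TentTree

/-! ### Young inequalities for the exponential class. -/

theorem one_add_le_exp_rpow {ε β : ℝ} (hε : 0 < ε) (hε1 : ε ≤ 1) (hβ : 0 ≤ β) :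
    1 + β ≤ 8 * Real.exp (β ^ (1 / ε) / 8) := by
  have h1 : β ≤ 1 + β ^ (1 / ε) := by
    rcases le_total β 1 with h | h
    · have := Real.rpow_nonneg hβ (1 / ε); linarith
    · have : β ^ (1 : ℝ) ≤ β ^ (1 / ε) :=
        Real.rpow_le_rpow_of_exponent_le h ((one_le_div hε).2 hε1)
      rw [Real.rpow_one] at this
      linarith
  have := Real.add_one_le_exp (β ^ (1 / ε) / 8)
  linarith

theorem one_add_pow_four_le {ε β : ℝ} (hε : 0 < ε) (hε1 : ε ≤ 1) (hβ : 0 ≤ β) :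
    (1 + β) ^ 4 ≤ 4096 * Real.exp (β ^ (1 / ε)) := by
  have h := pow_le_pow_left₀ (by positivity) (one_add_le_exp_rpow hε hε1 hβ) 4
  refine h.trans ?_
  rw [mul_pow, ← Real.exp_nat_mul]
  have h0 := Real.rpow_nonneg hβ (1 / ε)
  have : Real.exp ((4 : ℕ) * (β ^ (1 / ε) / 8)) ≤ Real.exp (β ^ (1 / ε)) :=
    Real.exp_le_exp.2 (by push_cast; linarith)
  linarith

/-- A Young inequality for the pair of `t (1 + log⁺ t) ^ ε` and `exp (t ^ (1 / ε))`, with a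
parameter. -/
theorem one_add_mul_le {ε β g σ : ℝ} (hε : 0 < ε) (hε1 : ε ≤ 1) (hβ : 0 ≤ β) (hg : 0 ≤ g)
    (hσ : 0 < σ) (hσ1 : σ ≤ 1) :
    (1 + β) * g ≤ 9 * (σ⁻¹ * (g * (1 + Real.posLog g) ^ ε) + σ ^ 3 * Real.exp (β ^ (1 / ε))) := by
  set x := β ^ (1 / ε) with hx
  have hx0 : 0 ≤ x := Real.rpow_nonneg hβ _
  have hl : 0 ≤ Real.posLog g := Real.posLog_nonneg
  have hone : 1 ≤ (1 + Real.posLog g) ^ ε := Real.one_le_rpow (by linarith) hε.le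
  have hgF : g ≤ g * (1 + Real.posLog g) ^ ε := le_mul_of_one_le_right hg hone
  have hσi : 1 ≤ σ⁻¹ := (one_le_inv₀ hσ).2 hσ1
  have hE := Real.exp_pos x
  -- If `x` is at most `8 log⁺ g`, then `β` is at most `8 (1 + log⁺ g)^ε` and the first term
  -- suffices. Otherwise `1 + β` and `g` cost a factor `exp (x/8)` each, so the product is at most
  -- `8 exp (x/4) min(g, 1)`. Comparing `exp (x/4)` with `σ⁻¹` then decides between the two terms;
  -- the three spare powers of `exp (x/4)` pay for `σ³`.
  rcases le_or_gt x (8 * Real.posLog g) with h | h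
  · have h1 : β ≤ 8 * (1 + Real.posLog g) ^ ε := by
      have e : β = x ^ ε := by
        rw [hx, ← Real.rpow_mul hβ, one_div_mul_cancel hε.ne', Real.rpow_one]
      rw [e]
      calc x ^ ε ≤ (8 * (1 + Real.posLog g)) ^ ε := by
            apply Real.rpow_le_rpow hx0 _ hε.le; linarith
        _ = 8 ^ ε * (1 + Real.posLog g) ^ ε := Real.mul_rpow (by norm_num) (by linarith)
        _ ≤ 8 * (1 + Real.posLog g) ^ ε := by
            gcongr
            calc (8 : ℝ) ^ ε ≤ 8 ^ (1 : ℝ) :=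
                  Real.rpow_le_rpow_of_exponent_le (by norm_num) hε1
              _ = 8 := Real.rpow_one _
    have h2 : (1 + β) * g ≤ 9 * (g * (1 + Real.posLog g) ^ ε) := by nlinarith
    have h3 : g * (1 + Real.posLog g) ^ ε ≤ σ⁻¹ * (g * (1 + Real.posLog g) ^ ε) :=
      le_mul_of_one_le_left (by positivity) hσi
    have h4 : 0 < σ ^ 3 * Real.exp x := by positivity
    linarith
  · set m := min g 1
    have hm0 : 0 ≤ m := le_min hg zero_le_one
    have hgm : g ≤ Real.exp (x / 8) * m := by
      rcases le_total g 1 with h1 | h1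
      · rw [show m = g from min_eq_left h1]
        exact le_mul_of_one_le_left hg (Real.one_le_exp (by positivity))
      · rw [show m = 1 from min_eq_right h1, mul_one]
        have : Real.posLog g = Real.log g := Real.posLog_eq_log (by rwa [abs_of_nonneg hg])
        rw [← Real.log_le_iff_le_exp (by linarith)]
        linarith
    have h1 : (1 + β) * g ≤ 8 * (Real.exp (x / 4) * m) := by
      calc (1 + β) * g ≤ (8 * Real.exp (x / 8)) * (Real.exp (x / 8) * m) := by
            gcongr; exact one_add_le_exp_rpow hε hε1 hβ
        _ = 8 * ((Real.exp (x / 8) * Real.exp (x / 8)) * m) := by ring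
        _ = _ := by rw [← Real.exp_add]; ring_nf
    have hE4 : Real.exp x = Real.exp (x / 4) ^ 4 := by rw [← Real.exp_nat_mul]; ring_nf
    have hq := Real.exp_pos (x / 4)
    have h2 : Real.exp (x / 4) * m ≤
        σ⁻¹ * (g * (1 + Real.posLog g) ^ ε) + σ ^ 3 * Real.exp x := by
      rcases le_total (Real.exp (x / 4)) σ⁻¹ with h3 | h3
      · have : Real.exp (x / 4) * m ≤ σ⁻¹ * (g * (1 + Real.posLog g) ^ ε) := by
          gcongr; exact (min_le_left _ _).trans hgF
        have h4 : 0 < σ ^ 3 * Real.exp x := by positivity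
        linarith
      · have h5 : 1 ≤ σ * Real.exp (x / 4) := by
          rwa [inv_le_iff_one_le_mul₀' hσ] at h3
        have : Real.exp (x / 4) * m ≤ σ ^ 3 * Real.exp x := by
          calc Real.exp (x / 4) * m ≤ Real.exp (x / 4) * 1 := by
                gcongr; exact min_le_right _ _
            _ ≤ Real.exp (x / 4) * (σ * Real.exp (x / 4)) ^ 3 := by
                gcongr; exact one_le_pow₀ h5
            _ = _ := by rw [hE4]; ring
        have h4 : 0 ≤ σ⁻¹ * (g * (1 + Real.posLog g) ^ ε) := by positivity
        linarith
    have h4 : 0 ≤ σ⁻¹ * (g * (1 + Real.posLog g) ^ ε) := by positivity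
    have h5 : 0 < σ ^ 3 * Real.exp x := by positivity
    linarith

/-! ### The sparse operator of one dyadic system. -/

theorem SphereDyadicSystem.restrict_unitBall_tent_inter {n : ℕ} {θ₀ : ℝ}
    (Q : SphereDyadicSystem n (Real.exp (-2 * θ₀))) (K : Q.Kube) (s : Set (Cn n)) :
    (volume.restrict (unitBall n)) (Q.tent θ₀ K ∩ s) = volume (Q.tent θ₀ K ∩ s) :=
  Measure.restrict_eq_self _ (Set.inter_subset_left.trans (Q.tent_subset_unitBall K))

theorem exp_neg_div_four_pow (θ₀ : ℝ) (d : ℕ) :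
    Real.exp (-θ₀ / 4) ^ (8 * d) = Real.exp (-2 * θ₀) ^ d := by
  rw [← Real.exp_nat_mul, ← Real.exp_nat_mul]
  push_cast
  ring_nf

theorem SphereDyadicSystem.volume_tent_inter_iUnion_le {n : ℕ} {θ₀ : ℝ}
    (Q : SphereDyadicSystem n (Real.exp (-2 * θ₀))) (hn : 1 ≤ n) (hθ : 0 < θ₀) (K : Q.Kube)
    (d : ℕ) : volume (Q.tent θ₀ K ∩ ⋃ j, Q.tent θ₀ ⟨K.1 + d, j⟩) ≤
      ENNReal.ofReal (4 * n * Real.exp (-2 * θ₀) ^ d) * volume (Q.tent θ₀ K) := by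
  refine (measure_mono (Set.inter_subset_inter_right _ ?_)).trans
    (Q.volume_tent_inter_le hn hθ K d)
  refine Set.iUnion_subset fun j z hz => ?_
  have h := Q.tanh_le_norm_of_mem_tent hn hθ (K := ⟨K.1 + d, j⟩) hz
  rw [Set.mem_ofPred_eq]
  exact h

/-- The dyadic Carleson tents of a dyadic system as a tent tree. -/
noncomputable def SphereDyadicSystem.tentTree {n : ℕ} {θ₀ : ℝ}
    (Q : SphereDyadicSystem n (Real.exp (-2 * θ₀))) (hn : 1 ≤ n) (hθ : 0 < θ₀) {C : ℝ}
    (hC : 0 < C) (hvol : ∀ K : Q.Kube, volume (Q.tent θ₀ K) ≤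
      ENNReal.ofReal (C * Real.exp (-2 * θ₀) ^ (K.1 * (n + 1)))) :
    TentTree (volume.restrict (unitBall n)) (ENNReal.ofReal (Real.exp (-θ₀ / 4)))
      (ENNReal.ofReal (C + 4 * n)) where
  card := Q.card
  tent := Q.tent θ₀
  size K := ENNReal.ofReal (Real.exp (-2 * θ₀) ^ (K.1 * (n + 1)))
  size_ne_zero K := by rw [ne_eq, ENNReal.ofReal_eq_zero, not_le]; positivity
  size_ne_top K := ENNReal.ofReal_ne_top
  measurableSet_tent := Q.measurableSet_tent hn hθ
  nested J K h z hJ hK := Q.tent_subset_tent hn hθ h hJ hK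
  eq_of_mem k i j z hi hj := Q.eq_of_mem_tent hn hθ hi hj
  measure_inter_le K d := by
    rw [Q.restrict_unitBall_tent_inter, Measure.restrict_eq_self _ (Q.tent_subset_unitBall K),
      ← ENNReal.ofReal_pow (Real.exp_pos _).le, exp_neg_div_four_pow,
      ← ENNReal.ofReal_mul (by positivity)]
    refine (Q.volume_tent_inter_iUnion_le hn hθ K d).trans ?_
    gcongr
    linarith
  measure_le K := by
    rw [Measure.restrict_eq_self _ (Q.tent_subset_unitBall K),
      ← ENNReal.ofReal_mul (by positivity)]
    refine (hvol K).trans (ENNReal.ofReal_le_ofReal ?_)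
    gcongr
    have : (0 : ℝ) ≤ 4 * n := by positivity
    linarith

/-- The weak type estimate for the sparse operator of one dyadic system. -/
theorem SphereDyadicSystem.exists_measure_sparse_le {n : ℕ} {θ₀ : ℝ} (hn : 1 ≤ n) (hθ : 0 < θ₀)
    (Q : SphereDyadicSystem n (Real.exp (-2 * θ₀))) {ε : ℝ} (hε : 0 < ε) (hε1 : ε ≤ 1)
    (κ : ℝ≥0∞) (hκ : κ ≠ 0) (hκ' : κ ≠ ⊤) :
    ∃ C : ℝ≥0∞, C ≠ ⊤ ∧ ∀ (β : Q.Kube → Cn n → ℝ) (g : Cn n → ℝ),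
      (∀ K z, 0 ≤ β K z) → (∀ z, 0 ≤ g z) →
      (∀ K, AEMeasurable (β K) (volume.restrict (unitBall n))) →
      AEMeasurable g (volume.restrict (unitBall n)) →
      (∀ K, ∫⁻ z in Q.tent θ₀ K, ENNReal.ofReal (Real.exp (β K z ^ (1 / ε))) ≤
        2 * volume (Q.tent θ₀ K)) →
      volume.restrict (unitBall n) {z | κ < ∑' K : Q.Kube, (Q.tent θ₀ K).indicator
        (fun z => ENNReal.ofReal (1 + β K z) *
          ((ENNReal.ofReal (Real.exp (-2 * θ₀) ^ (K.1 * (n + 1))))⁻¹ *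
            ∫⁻ w in Q.tent θ₀ K, ENNReal.ofReal ((1 + β K w) * g w))) z} ≤
        C * ∫⁻ z in unitBall n, ENNReal.ofReal (g z * (1 + Real.posLog (g z)) ^ ε) := by
  obtain ⟨C₀, hC₀, hvol⟩ := Q.exists_volume_tent_le hn hθ
  set M := ENNReal.ofReal (C₀ + 4 * n)
  have hM : M ≠ ⊤ := ENNReal.ofReal_ne_top
  -- Here `p^8 = δ`. The constant `8192 = 8⁴ · 2` bounds the fourth moment of `1 + β`, and `9 (1 +
  -- 2M)` comes from the Young inequality below.
  obtain ⟨C, hC, hweak⟩ := TentTree.exists_measure_tsum_indicator_le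
    (μ := volume.restrict (unitBall n)) (p := ENNReal.ofReal (Real.exp (-θ₀ / 4))) (M := M)
    (by rw [ne_eq, ENNReal.ofReal_eq_zero, not_le]; positivity)
    (by rw [ENNReal.ofReal_lt_one, Real.exp_lt_one_iff]; linarith) hM (9 * (1 + 2 * M)) 8192
    (by finiteness) (by simp) κ hκ hκ'
  refine ⟨C, hC, fun β g hβ hg hβm hgm hexp => ?_⟩
  have hrestr : ∀ K : Q.Kube, (volume.restrict (unitBall n)).restrict (Q.tent θ₀ K) =
      volume.restrict (Q.tent θ₀ K) := fun K =>
    Measure.restrict_restrict_of_subset (Q.tent_subset_unitBall K)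
  have hrestr' : ∀ K : Q.Kube, (volume.restrict (unitBall n)) (Q.tent θ₀ K) =
      volume (Q.tent θ₀ K) := fun K => Measure.restrict_eq_self _ (Q.tent_subset_unitBall K)
  have hmono : ∀ K : Q.Kube, volume.restrict (Q.tent θ₀ K) ≤ volume.restrict (unitBall n) :=
    fun K => Measure.restrict_mono (Q.tent_subset_unitBall K) le_rfl
  refine hweak (Q.tentTree hn hθ hC₀ hvol)
    (fun z => ENNReal.ofReal (g z * (1 + Real.posLog (g z)) ^ ε)) _
    (fun K z => ENNReal.ofReal (1 + β K z)) ?_ ?_ ?_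
  · exact fun K => ((hβm K).const_add 1).ennreal_ofReal
  · intro (K : Q.Kube)
    change ∫⁻ z in Q.tent θ₀ K, _ ∂(volume.restrict (unitBall n)) ≤
      8192 * (volume.restrict (unitBall n)) (Q.tent θ₀ K)
    rw [hrestr, hrestr']
    calc _ ≤ ∫⁻ z in Q.tent θ₀ K, 4096 * ENNReal.ofReal (Real.exp (β K z ^ (1 / ε))) := by
          refine lintegral_mono fun z => ?_
          have h := hβ K z
          rw [← ENNReal.ofReal_pow (by positivity)]
          refine (ENNReal.ofReal_le_ofReal (one_add_pow_four_le hε hε1 h)).trans_eq ?_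
          rw [ENNReal.ofReal_mul (by norm_num)]
          norm_num
      _ = 4096 * ∫⁻ z in Q.tent θ₀ K, ENNReal.ofReal (Real.exp (β K z ^ (1 / ε))) :=
          lintegral_const_mul' _ _ (by norm_num)
      _ ≤ 4096 * (2 * volume (Q.tent θ₀ K)) := by gcongr; exact hexp K
      _ = _ := by rw [← mul_assoc]; norm_num
  · intro (K : Q.Kube) m hK
    have hK' : ∫⁻ z in Q.tent θ₀ K, ENNReal.ofReal (g z * (1 + Real.posLog (g z)) ^ ε)
        ∂(volume.restrict (unitBall n)) ≤
        (16⁻¹) ^ m * ENNReal.ofReal (Real.exp (-2 * θ₀) ^ (K.1 * (n + 1))) := hK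
    rw [hrestr] at hK'
    clear hK
    have hsize : volume (Q.tent θ₀ K) ≤
        M * ENNReal.ofReal (Real.exp (-2 * θ₀) ^ (K.1 * (n + 1))) := by
      have := (Q.tentTree hn hθ hC₀ hvol).measure_le K
      change (volume.restrict (unitBall n)) (Q.tent θ₀ K) ≤ _ at this
      rwa [hrestr'] at this
    have hτ0 : ENNReal.ofReal (Real.exp (-2 * θ₀) ^ (K.1 * (n + 1))) ≠ 0 :=
      (Q.tentTree hn hθ hC₀ hvol).size_ne_zero K
    have hτ1 : ENNReal.ofReal (Real.exp (-2 * θ₀) ^ (K.1 * (n + 1))) ≠ ⊤ := ENNReal.ofReal_ne_top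
    generalize hτ : ENNReal.ofReal (Real.exp (-2 * θ₀) ^ (K.1 * (n + 1))) = τ at *
    have hσ : ∀ w, ENNReal.ofReal ((1 + β K w) * g w) ≤
        9 * (2 ^ m * ENNReal.ofReal (g w * (1 + Real.posLog (g w)) ^ ε) +
          (8⁻¹) ^ m * ENNReal.ofReal (Real.exp (β K w ^ (1 / ε)))) := by
      intro w
      -- The choice `σ = 2^(-m)` balances the two terms: `σ⁻¹ 16^(-m) = 8^(-m) = σ³`.
      have h := one_add_mul_le (σ := (1 / 2) ^ m) hε hε1 (hβ K w) (hg w) (by positivity)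
        (pow_le_one₀ (by norm_num) (by norm_num))
      have hF : 0 ≤ g w * (1 + Real.posLog (g w)) ^ ε := by
        have := hg w
        have : 0 ≤ Real.posLog (g w) := Real.posLog_nonneg
        positivity
      refine (ENNReal.ofReal_le_ofReal h).trans_eq ?_
      have e1 : (((1 : ℝ) / 2) ^ m)⁻¹ = 2 ^ m := by simp
      have e2 : (((1 : ℝ) / 2) ^ m) ^ 3 = (8⁻¹) ^ m := by
        rw [← pow_mul, mul_comm, pow_mul]; norm_num
      have e3 : ENNReal.ofReal (8⁻¹ : ℝ) = 8⁻¹ := by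
        rw [ENNReal.ofReal_inv_of_pos (by norm_num)]; norm_num
      rw [e1, e2]
      generalize g w * (1 + Real.posLog (g w)) ^ ε = G at *
      rw [ENNReal.ofReal_mul (by norm_num), ENNReal.ofReal_add (by positivity)
        (by positivity), ENNReal.ofReal_mul (by positivity), ENNReal.ofReal_mul (by positivity),
        ENNReal.ofReal_pow (by norm_num), ENNReal.ofReal_pow (by norm_num), e3]
      norm_num
    calc τ⁻¹ * ∫⁻ w in Q.tent θ₀ K, ENNReal.ofReal ((1 + β K w) * g w)
        ≤ τ⁻¹ * ∫⁻ w in Q.tent θ₀ K,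
          9 * (2 ^ m * ENNReal.ofReal (g w * (1 + Real.posLog (g w)) ^ ε) +
          (8⁻¹) ^ m * ENNReal.ofReal (Real.exp (β K w ^ (1 / ε)))) := by
          gcongr; exact hσ _
      _ = τ⁻¹ * (9 * (2 ^ m * (∫⁻ w in Q.tent θ₀ K,
            ENNReal.ofReal (g w * (1 + Real.posLog (g w)) ^ ε)) +
          (8⁻¹) ^ m * ∫⁻ w in Q.tent θ₀ K, ENNReal.ofReal (Real.exp (β K w ^ (1 / ε))))) := by
          rw [lintegral_const_mul' _ _ (by norm_num), lintegral_add_right',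
            lintegral_const_mul' _ _ (by finiteness), lintegral_const_mul' _ _ (by finiteness)]
          refine AEMeasurable.const_mul ?_ _
          exact (Real.measurable_exp.comp_aemeasurable
            (((hβm K).mono_measure (hmono K)).pow_const _)).ennreal_ofReal
      _ ≤ τ⁻¹ * (9 * (2 ^ m * ((16⁻¹) ^ m * τ) + (8⁻¹) ^ m * (2 * (M * τ)))) := by
          gcongr
          exact (hexp K).trans (mul_le_mul_right hsize 2)
      _ = (τ⁻¹ * τ) * (9 * ((2 ^ m * (16⁻¹) ^ m) + (8⁻¹) ^ m * (2 * M))) := by ring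
      _ = _ := by
          have e : (2 : ℝ≥0∞) ^ m * (16⁻¹) ^ m = (8⁻¹) ^ m := by
            rw [← mul_pow]
            congr 1
            rw [show (16 : ℝ≥0∞) = 2 * 8 by norm_num, ENNReal.mul_inv (by simp) (by simp),
              ← mul_assoc, ENNReal.mul_inv_cancel (by simp) (by simp), one_mul]
          rw [ENNReal.inv_mul_cancel hτ0 hτ1, e]
          ring

/-! ### Domination of the commutator. -/

/-- The commutator as a single integral. -/
theorem commutator_eq {n : ℕ} {g f : Cn n → ℂ}
    (hfi : IntegrableOn f (unitBall n)) (hgf : IntegrableOn (fun w => g w * f w) (unitBall n))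
    {z : Cn n} (hz : z ∈ unitBall n) :
    commutator n g f z = ((n.factorial : ℂ) / (Real.pi : ℂ) ^ n) *
      ∫ w in unitBall n, (g z - g w) * f w / (1 - inner ℂ w z) ^ (n + 1) := by
  have hz1 : ‖z‖ < 1 := by simpa [unitBall] using hz
  set k : Cn n → ℂ := fun w => ((1 - inner ℂ w z) ^ (n + 1))⁻¹ with hk
  have hkm : Measurable k := by
    have : Continuous fun w : Cn n => (1 - inner ℂ w z : ℂ) ^ (n + 1) := by fun_prop
    exact this.measurable.inv
  have hkb : ∀ w ∈ unitBall n, ‖k w‖ ≤ ((1 - ‖z‖) ^ (n + 1))⁻¹ := by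
    intro w hw
    have hw1 : ‖w‖ < 1 := by simpa [unitBall] using hw
    rw [hk, norm_inv, norm_pow]
    have h1 := norm_sub_norm_le (1 : ℂ) (inner ℂ w z)
    have h2 := norm_inner_le_norm (𝕜 := ℂ) w z
    rw [norm_one] at h1
    have h3 : 1 - ‖z‖ ≤ ‖(1 : ℂ) - inner ℂ w z‖ := by nlinarith [norm_nonneg z]
    have h4 : 0 < 1 - ‖z‖ := by linarith
    gcongr
  have hint : ∀ h : Cn n → ℂ, IntegrableOn h (unitBall n) →
      IntegrableOn (fun w => h w * k w) (unitBall n) := fun h hh =>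
    Integrable.mul_bdd hh hkm.aestronglyMeasurable (c := ((1 - ‖z‖) ^ (n + 1))⁻¹)
      ((ae_restrict_iff' measurableSet_ball).2 (Filter.Eventually.of_forall hkb))
  have e1 : ∀ w, (g z - g w) * f w / (1 - inner ℂ w z) ^ (n + 1) =
      g z * (f w * k w) - (g w * f w) * k w := fun w => by simp only [hk]; ring
  simp_rw [e1]
  rw [integral_sub ((hint f hfi).const_mul _) (hint _ hgf), integral_const_mul]
  simp only [commutator, bergmanProj, div_eq_mul_inv, hk]
  ring

theorem norm_sub_le_mul {a b m : ℂ} {c : ℝ} (hc : 0 < c) :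
    ‖a - b‖ ≤ c * ((1 + ‖a - m‖ / c) * (1 + ‖b - m‖ / c)) := by
  have h1 : ‖a - b‖ ≤ ‖a - m‖ + ‖b - m‖ := by
    rw [show a - b = (a - m) - (b - m) by ring]; exact norm_sub_le _ _
  have e1 : ‖a - m‖ = c * (‖a - m‖ / c) := by field_simp
  have e2 : ‖b - m‖ = c * (‖b - m‖ / c) := by field_simp
  rw [e1, e2] at h1
  have h3 : 0 ≤ ‖a - m‖ / c := by positivity
  have h4 : 0 ≤ ‖b - m‖ / c := by positivity
  have : 0 ≤ c * (1 + (‖a - m‖ / c) * (‖b - m‖ / c)) := by positivity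
  linarith

/-- Pointwise domination of the commutator by sparse operators over the dyadic tents. -/
theorem exists_enorm_commutator_le {n : ℕ} {θ₀ : ℝ} (hn : 1 ≤ n) (hθ : 0 < θ₀)
    (D : DyadicFamily n θ₀) : ∃ C : ℝ, 0 < C ∧ ∀ (b f : Cn n → ℂ)
      (m : ∀ ℓ, (D.system ℓ).Kube → ℂ) (c lam : ℝ), 0 < c → 0 < lam →
      AEStronglyMeasurable b (volume.restrict (unitBall n)) →
      IntegrableOn f (unitBall n) → IntegrableOn (fun w => b w * f w) (unitBall n) →
      ∀ z ∈ unitBall n, ‖commutator n (fun w => (starRingEnd ℂ) (b w)) f z‖ₑ ≤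
        ENNReal.ofReal (C * lam) * ∑ ℓ, ∑' K : (D.system ℓ).Kube,
          ((D.system ℓ).tent θ₀ K).indicator (fun z => ENNReal.ofReal (1 + ‖b z - m ℓ K‖ / c) *
            ((ENNReal.ofReal (Real.exp (-2 * θ₀) ^ (K.1 * (n + 1))))⁻¹ *
              ∫⁻ w in (D.system ℓ).tent θ₀ K,
                ENNReal.ofReal ((1 + ‖b w - m ℓ K‖ / c) * (‖f w‖ * c / lam)))) z := by
  obtain ⟨C, hC, htent⟩ := exists_tent_of_mem_unitBall hn hθ D
  set a : ℝ := n.factorial / Real.pi ^ n with ha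
  have ha0 : 0 < a := by positivity
  refine ⟨a * C ^ (n + 1), by positivity, fun b f m c lam hc hlam hb hf hbf z hz => ?_⟩
  have hbf' : IntegrableOn (fun w => (starRingEnd ℂ) (b w) * f w) (unitBall n) := by
    refine Integrable.mono hbf ?_ (Filter.Eventually.of_forall fun w => by simp)
    exact (Complex.continuous_conj.comp_aestronglyMeasurable hb).mul hf.aestronglyMeasurable
  rw [commutator_eq hf hbf' hz, enorm_mul]
  have hae : ‖((n.factorial : ℂ) / (Real.pi : ℂ) ^ n)‖ₑ = ENNReal.ofReal a := by
    rw [← ofReal_norm]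
    congr 1
    rw [norm_div, norm_pow, Complex.norm_natCast, Complex.norm_real,
      Real.norm_of_nonneg Real.pi_pos.le]
  set τ : ℕ → ℝ := fun k => Real.exp (-2 * θ₀) ^ (k * (n + 1)) with hτ
  have hτ0 : ∀ k, 0 < τ k := fun k => by positivity
  set B : ∀ ℓ, (D.system ℓ).Kube → Cn n → ℝ := fun ℓ K w => 1 + ‖b w - m ℓ K‖ / c with hB
  have hB0 : ∀ ℓ K w, 0 < B ℓ K w := fun ℓ K w => by positivity
  set G : Cn n → ℝ := fun w => ‖f w‖ * c / lam with hG
  have hG0 : ∀ w, 0 ≤ G w := fun w => by positivity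
  have hGm : AEMeasurable G (volume.restrict (unitBall n)) :=
    ((hf.aestronglyMeasurable.norm.aemeasurable).mul_const c).div_const lam
  have hBm : ∀ ℓ K, AEMeasurable (B ℓ K) (volume.restrict (unitBall n)) := fun ℓ K =>
    (((hb.sub aestronglyMeasurable_const).norm.aemeasurable).div_const c).const_add 1
  have hmt : ∀ ℓ K, MeasurableSet ((D.system ℓ).tent θ₀ K) := fun ℓ K =>
    (D.system ℓ).measurableSet_tent hn hθ K
  set W : ∀ ℓ, (D.system ℓ).Kube → Cn n → ℝ≥0∞ := fun ℓ K w =>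
    ((D.system ℓ).tent θ₀ K).indicator (fun z => ENNReal.ofReal (B ℓ K z) *
      (ENNReal.ofReal (τ K.1))⁻¹) z *
      ((D.system ℓ).tent θ₀ K).indicator (fun w => ENNReal.ofReal (B ℓ K w * G w)) w with hW
  have hBGm : ∀ ℓ K, AEMeasurable (((D.system ℓ).tent θ₀ K).indicator
      fun w => ENNReal.ofReal (B ℓ K w * G w)) (volume.restrict (unitBall n)) := fun ℓ K =>
    (((hBm ℓ K).mul hGm).ennreal_ofReal).indicator (hmt ℓ K)
  have hWm : ∀ ℓ K, AEMeasurable (W ℓ K) (volume.restrict (unitBall n)) := fun ℓ K =>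
    (hBGm ℓ K).const_mul _
  have hpt : ∀ w ∈ unitBall n,
      ‖((starRingEnd ℂ) (b z) - (starRingEnd ℂ) (b w)) * f w / (1 - inner ℂ w z) ^ (n + 1)‖ₑ ≤
        ENNReal.ofReal (C ^ (n + 1) * lam) * ∑ ℓ, ∑' K : (D.system ℓ).Kube, W ℓ K w := by
    intro w hw
    -- The tent depends on `w`; summing over all tents of all systems avoids any choice that varies
    -- under the integral.
    obtain ⟨ℓ, K, hzK, hwK, hd⟩ := htent z hz w hw
    have hle : W ℓ K w ≤ ∑ ℓ, ∑' K : (D.system ℓ).Kube, W ℓ K w :=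
      (ENNReal.le_tsum K).trans (Finset.single_le_sum (f := fun ℓ => ∑' K, W ℓ K w)
        (fun _ _ => zero_le) (Finset.mem_univ ℓ))
    refine le_trans ?_ (mul_le_mul_right hle _)
    have hWe : W ℓ K w = ENNReal.ofReal (B ℓ K z * (τ K.1)⁻¹ * (B ℓ K w * G w)) := by
      have h1 := hB0 ℓ K z
      have h2 := hτ0 K.1
      simp only [hW, hzK, hwK, Set.indicator_of_mem]
      rw [← ENNReal.ofReal_inv_of_pos h2, ← ENNReal.ofReal_mul h1.le,
        ← ENNReal.ofReal_mul (by positivity)]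
    rw [hWe, ← ENNReal.ofReal_mul (by positivity), ← ofReal_norm]
    refine ENNReal.ofReal_le_ofReal ?_
    rw [norm_div, norm_mul, norm_pow, ← map_sub, RCLike.norm_conj]
    have hab := norm_sub_le_mul (a := b z) (b := b w) (m := m ℓ K) hc
    have hdpos : 0 < ‖(1 : ℂ) - inner ℂ w z‖ := by
      have : 0 < C * ‖(1 : ℂ) - inner ℂ w z‖ := lt_of_lt_of_le (by positivity) hd
      exact pos_of_mul_pos_right this hC.le
    have hτd : τ K.1 ≤ C ^ (n + 1) * ‖(1 : ℂ) - inner ℂ w z‖ ^ (n + 1) := by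
      rw [← mul_pow, hτ]
      simp only [pow_mul]
      gcongr
    rw [div_le_iff₀ (by positivity)]
    have hτK := hτ0 K.1
    have hBz := hB0 ℓ K z
    have hBw := hB0 ℓ K w
    have e : c * ‖f w‖ = lam * G w := by simp only [hG]; field_simp
    calc ‖b z - b w‖ * ‖f w‖ ≤ (c * (B ℓ K z * B ℓ K w)) * ‖f w‖ := by
          gcongr
      _ = lam * (B ℓ K z * (B ℓ K w * G w)) * ((τ K.1)⁻¹ * τ K.1) := by
          rw [inv_mul_cancel₀ hτK.ne', mul_one]
          linear_combination (B ℓ K z * B ℓ K w) * e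
      _ ≤ lam * (B ℓ K z * (B ℓ K w * G w)) *
            ((τ K.1)⁻¹ * (C ^ (n + 1) * ‖(1 : ℂ) - inner ℂ w z‖ ^ (n + 1))) := by
          have := hG0 w
          gcongr
      _ = _ := by ring
  calc _ ≤ ENNReal.ofReal a * ∫⁻ w in unitBall n,
        ‖((starRingEnd ℂ) (b z) - (starRingEnd ℂ) (b w)) * f w /
          (1 - inner ℂ w z) ^ (n + 1)‖ₑ := by
        rw [hae]
        gcongr
        exact enorm_integral_le_lintegral_enorm _
    _ ≤ ENNReal.ofReal a * ∫⁻ w in unitBall n,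
        ENNReal.ofReal (C ^ (n + 1) * lam) * ∑ ℓ, ∑' K : (D.system ℓ).Kube, W ℓ K w := by
        refine mul_le_mul_right ?_ _
        exact setLIntegral_mono_ae' measurableSet_ball (Filter.Eventually.of_forall hpt)
    _ = ENNReal.ofReal (a * C ^ (n + 1) * lam) * ∑ ℓ, ∑' K : (D.system ℓ).Kube,
        ∫⁻ w in unitBall n, W ℓ K w := by
        rw [lintegral_const_mul' _ _ ENNReal.ofReal_ne_top, ← mul_assoc,
          ← ENNReal.ofReal_mul ha0.le, mul_assoc a,
          lintegral_finsetSum' _ fun ℓ _ => AEMeasurable.tsum fun K => hWm ℓ K]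
        congr 1
        exact Finset.sum_congr rfl fun ℓ _ => lintegral_tsum fun K => hWm ℓ K
    _ = _ := by
        congr 1
        refine Finset.sum_congr rfl fun ℓ _ => tsum_congr fun K => ?_
        simp only [hW]
        rw [lintegral_const_mul'' _ (hBGm ℓ K),
          lintegral_indicator (hmt ℓ K),
          Measure.restrict_restrict_of_subset ((D.system ℓ).tent_subset_unitBall K)]
        by_cases hzK : z ∈ (D.system ℓ).tent θ₀ K
        · simp only [hzK, Set.indicator_of_mem]
          rw [mul_assoc]
        · simp [hzK]

/-! ### From sparse operators to the commutator, and the oscillation norm. -/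

theorem lintegral_exp_le_of_expOscSup_le {n : ℕ} {θ₀ : ℝ} (D : DyadicFamily n θ₀) {b : Cn n → ℂ}
    {r c : ℝ} {M : ℝ≥0∞} (h : expOscSup D b r c ≤ M) (ℓ : Fin D.N) (K : (D.system ℓ).Kube) :
    ∫⁻ w in (D.system ℓ).tent θ₀ K,
      ENNReal.ofReal (Real.exp ((‖b w - ⨍ u in (D.system ℓ).tent θ₀ K, b u‖ / c) ^ r)) ≤
        M * volume ((D.system ℓ).tent θ₀ K) := by
  have h1 := (iSup₂_le_iff.1 h) ℓ K
  have htop : volume ((D.system ℓ).tent θ₀ K) ≠ ⊤ :=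
    ((measure_mono ((D.system ℓ).tent_subset_unitBall K)).trans_lt measure_ball_lt_top).ne
  by_cases h0 : volume ((D.system ℓ).tent θ₀ K) = 0
  · rw [Measure.restrict_eq_zero.2 h0]; simp
  · rw [mul_comm M]
    rwa [ENNReal.inv_mul_le_iff h0 htop] at h1

theorem exists_weak_type_of_expOscSup_le {n : ℕ} (hn : 1 ≤ n) {θ₀ : ℝ} (hθ : 0 < θ₀)
    (D : DyadicFamily n θ₀) {ε : ℝ} (hε : 0 < ε) (hε1 : ε ≤ 1) :
    ∃ C : ℝ, 0 < C ∧ ∀ (b : Cn n → ℂ) (c : ℝ), LocallyIntegrableOn b (unitBall n) → 0 < c →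
      expOscSup D b (1 / ε) c ≤ 2 →
      ∀ f : Cn n → ℂ, AEStronglyMeasurable f (volume.restrict (unitBall n)) →
        (∃ M : ℝ, ∀ z, ‖f z‖ ≤ M) → HasCompactSupport f → tsupport f ⊆ unitBall n →
        ∀ lam : ℝ, 0 < lam →
          volume {z | z ∈ unitBall n ∧
              lam < ‖commutator n (fun w => (starRingEnd ℂ) (b w)) f z‖} ≤
            ENNReal.ofReal (C * c) *
              ∫⁻ z in unitBall n, ENNReal.ofReal (‖f z‖ / lam *
                (1 + Real.posLog (‖f z‖ * c / lam)) ^ ε) := by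
  obtain ⟨A, hA, hdom⟩ := exists_enorm_commutator_le hn hθ D
  -- If every one of the `N` sparse sums is at most `κ`, the commutator is at most `λ N / (N + 1) ≤
  -- λ`.
  set κ : ℝ≥0∞ := ENNReal.ofReal (1 / (A * (D.N + 1))) with hκ
  have hκ0 : κ ≠ 0 := by rw [hκ, ne_eq, ENNReal.ofReal_eq_zero, not_le]; positivity
  choose C hC hweak using fun ℓ => (D.system ℓ).exists_measure_sparse_le hn hθ hε hε1 κ hκ0
    ENNReal.ofReal_ne_top
  have hsum : ∑ ℓ, C ℓ ≠ ⊤ := ENNReal.sum_ne_top.2 fun ℓ _ => hC ℓ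
  refine ⟨(∑ ℓ, C ℓ).toReal + 1, by positivity, fun b c hb hc hosc f hf hfb hfc hfs lam hlam => ?_⟩
  obtain ⟨M, hM⟩ := hfb
  have hbm : AEStronglyMeasurable b (volume.restrict (unitBall n)) := hb.aestronglyMeasurable
  have : IsFiniteMeasure (volume.restrict (unitBall n)) :=
    ⟨by rw [Measure.restrict_apply_univ]; exact measure_ball_lt_top⟩
  have hfi : IntegrableOn f (unitBall n) :=
    Integrable.of_bound hf M (Filter.Eventually.of_forall hM)
  have hbf : IntegrableOn (fun w => b w * f w) (unitBall n) := by
    have h1 : IntegrableOn b (tsupport f) := hb.integrableOn_compact_subset hfs hfc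
    have h2 : IntegrableOn (fun w => b w * f w) (tsupport f) := by
      refine Integrable.mul_bdd (c := M) h1 (hf.mono_measure (Measure.restrict_mono hfs le_rfl))
        (Filter.Eventually.of_forall hM)
    refine h2.of_forall_sdiff_eq_zero measurableSet_ball fun w hw => ?_
    rw [image_eq_zero_of_notMem_tsupport hw.2, mul_zero]
  set m : ∀ ℓ, (D.system ℓ).Kube → ℂ := fun ℓ K => ⨍ u in (D.system ℓ).tent θ₀ K, b u with hm
  set S : Fin D.N → Cn n → ℝ≥0∞ := fun ℓ z => ∑' K : (D.system ℓ).Kube,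
    ((D.system ℓ).tent θ₀ K).indicator (fun z => ENNReal.ofReal (1 + ‖b z - m ℓ K‖ / c) *
      ((ENNReal.ofReal (Real.exp (-2 * θ₀) ^ (K.1 * (n + 1))))⁻¹ *
        ∫⁻ w in (D.system ℓ).tent θ₀ K,
          ENNReal.ofReal ((1 + ‖b w - m ℓ K‖ / c) * (‖f w‖ * c / lam)))) z with hS
  have hsub : {z | z ∈ unitBall n ∧
      lam < ‖commutator n (fun w => (starRingEnd ℂ) (b w)) f z‖} ⊆
      ⋃ ℓ, ({z | κ < S ℓ z} ∩ unitBall n) := by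
    rintro z ⟨hz, hlt⟩
    by_contra hnot
    have hle : ∀ ℓ, S ℓ z ≤ κ := by
      intro ℓ
      by_contra h
      exact hnot (Set.mem_iUnion.2 ⟨ℓ, not_le.1 h, hz⟩)
    have h1 := hdom b f m c lam hc hlam hbm hfi hbf z hz
    have h2 : ∑ ℓ, S ℓ z ≤ D.N * κ := by
      refine (Finset.sum_le_sum fun ℓ _ => hle ℓ).trans_eq ?_
      simp
    have h3 : ‖commutator n (fun w => (starRingEnd ℂ) (b w)) f z‖ₑ ≤ ENNReal.ofReal lam := by
      refine h1.trans ((mul_le_mul_right h2 _).trans ?_)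
      rw [hκ, ← ENNReal.ofReal_natCast, ← ENNReal.ofReal_mul (by positivity),
        ← ENNReal.ofReal_mul (by positivity)]
      refine ENNReal.ofReal_le_ofReal ?_
      have : A * lam * (D.N * (1 / (A * (D.N + 1)))) = lam * (D.N / (D.N + 1)) := by
        field_simp
      rw [this]
      refine mul_le_of_le_one_right hlam.le ?_
      rw [div_le_one (by positivity)]
      linarith
    rw [← ofReal_norm, ENNReal.ofReal_le_ofReal_iff hlam.le] at h3
    linarith
  have hI : ∫⁻ z in unitBall n, ENNReal.ofReal ((‖f z‖ * c / lam) *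
      (1 + Real.posLog (‖f z‖ * c / lam)) ^ ε) = ENNReal.ofReal c *
      ∫⁻ z in unitBall n, ENNReal.ofReal (‖f z‖ / lam *
        (1 + Real.posLog (‖f z‖ * c / lam)) ^ ε) := by
    rw [← lintegral_const_mul' _ _ ENNReal.ofReal_ne_top]
    refine lintegral_congr fun z => ?_
    rw [← ENNReal.ofReal_mul hc.le]
    congr 1
    ring
  calc _ ≤ ∑ ℓ, volume.restrict (unitBall n) {z | κ < S ℓ z} := by
        refine (measure_mono hsub).trans ((measure_iUnion_fintype_le _ _).trans_eq ?_)
        refine Finset.sum_congr rfl fun ℓ _ => ?_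
        exact (Measure.restrict_apply' measurableSet_ball).symm
    _ ≤ ∑ ℓ, C ℓ * ∫⁻ z in unitBall n, ENNReal.ofReal ((‖f z‖ * c / lam) *
          (1 + Real.posLog (‖f z‖ * c / lam)) ^ ε) := by
        refine Finset.sum_le_sum fun ℓ _ => hweak ℓ (fun K z => ‖b z - m ℓ K‖ / c)
          (fun z => ‖f z‖ * c / lam) (fun K z => by positivity) (fun z => by positivity) ?_ ?_ ?_
        · exact fun K => ((hbm.sub aestronglyMeasurable_const).norm.aemeasurable).div_const c
        · exact ((hf.norm.aemeasurable).mul_const c).div_const lam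
        · exact fun K => lintegral_exp_le_of_expOscSup_le D hosc ℓ K
    _ ≤ ENNReal.ofReal ((∑ ℓ, C ℓ).toReal + 1) * ∫⁻ z in unitBall n,
          ENNReal.ofReal ((‖f z‖ * c / lam) * (1 + Real.posLog (‖f z‖ * c / lam)) ^ ε) := by
        rw [← Finset.sum_mul]
        gcongr
        rw [← ENNReal.ofReal_toReal hsum]
        exact ENNReal.ofReal_le_ofReal (by simp)
    _ = _ := by rw [hI, ← mul_assoc, ← ENNReal.ofReal_mul (by positivity)]

/-- Enlarging `c` by `t^(1/r)` divides the exponent `u` by `t`, and Bernoulli's inequality gives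
`exp (u/t) ≤ 1 + t⁻¹ exp u`. With `t` at least the old supremum, the new averages are at most `2`.
This makes the set defining `oscNorm` nonempty. -/
theorem exists_expOscSup_le_two {n : ℕ} {θ₀ : ℝ} (D : DyadicFamily n θ₀) {b : Cn n → ℂ} {r : ℝ}
    (hr : 0 < r) (hb : MemOsc D r b) : ∃ c : ℝ, 0 < c ∧ expOscSup D b r c ≤ 2 := by
  obtain ⟨-, c, hc, hlt⟩ := hb
  set t : ℝ := max 1 (expOscSup D b r c).toReal with ht
  have ht1 : 1 ≤ t := le_max_left _ _
  have ht0 : 0 < t := by linarith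
  have hM : expOscSup D b r c ≤ ENNReal.ofReal t := by
    rw [← ENNReal.ofReal_toReal hlt.ne]
    exact ENNReal.ofReal_le_ofReal (le_max_right _ _)
  have htr : (t ^ (1 / r)) ^ r = t := by
    rw [← Real.rpow_mul ht0.le, one_div_mul_cancel hr.ne', Real.rpow_one]
  have htr0 : 0 < t ^ (1 / r) := Real.rpow_pos_of_pos ht0 _
  refine ⟨c * t ^ (1 / r), by positivity, iSup₂_le fun ℓ K => ?_⟩
  set T := (D.system ℓ).tent θ₀ K with hT
  set m := ⨍ u in T, b u with hm
  have h1 := lintegral_exp_le_of_expOscSup_le D hM ℓ K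
  have hpt : ∀ w, ENNReal.ofReal (Real.exp ((‖b w - m‖ / (c * t ^ (1 / r))) ^ r)) ≤
      ENNReal.ofReal t⁻¹ * ENNReal.ofReal (Real.exp ((‖b w - m‖ / c) ^ r)) + 1 := by
    intro w
    rw [← ENNReal.ofReal_mul (by positivity), ← ENNReal.ofReal_one,
      ← ENNReal.ofReal_add (by positivity) zero_le_one]
    refine ENNReal.ofReal_le_ofReal ?_
    have e : (‖b w - m‖ / (c * t ^ (1 / r))) ^ r = (‖b w - m‖ / c) ^ r * t⁻¹ := by
      rw [← div_div, Real.div_rpow (by positivity) htr0.le, htr, div_eq_mul_inv]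
    rw [e, Real.exp_mul]
    set u := (‖b w - m‖ / c) ^ r
    have hu := Real.exp_pos u
    have := rpow_one_add_le_one_add_mul_self (s := Real.exp u - 1) (by linarith)
      (p := t⁻¹) (by positivity) (inv_le_one_of_one_le₀ ht1)
    rw [add_sub_cancel] at this
    have h0 : 0 < t⁻¹ := by positivity
    linarith
  have htop : volume T ≠ ⊤ :=
    ((measure_mono ((D.system ℓ).tent_subset_unitBall K)).trans_lt measure_ball_lt_top).ne
  calc _ ≤ (volume T)⁻¹ * ∫⁻ w in T,
        (ENNReal.ofReal t⁻¹ * ENNReal.ofReal (Real.exp ((‖b w - m‖ / c) ^ r)) + 1) := by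
        gcongr; exact hpt _
    _ = (volume T)⁻¹ * (ENNReal.ofReal t⁻¹ *
        (∫⁻ w in T, ENNReal.ofReal (Real.exp ((‖b w - m‖ / c) ^ r))) + volume T) := by
        rw [lintegral_add_right _ measurable_const,
          lintegral_const_mul' _ _ ENNReal.ofReal_ne_top]
        simp
    _ ≤ (volume T)⁻¹ * (ENNReal.ofReal t⁻¹ * (ENNReal.ofReal t * volume T) + volume T) := by
        gcongr
    _ = 2 * ((volume T)⁻¹ * volume T) := by
        rw [← mul_assoc (ENNReal.ofReal t⁻¹), ← ENNReal.ofReal_mul (by positivity),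
          inv_mul_cancel₀ ht0.ne', ENNReal.ofReal_one]
        ring
    _ ≤ 2 * 1 := by gcongr; exact ENNReal.inv_mul_le_one _
    _ = 2 := mul_one _

theorem one_add_posLog_two_mul_rpow_le {ε x : ℝ} (hε : 0 < ε) (hε1 : ε ≤ 1) :
    (1 + Real.posLog (2 * x)) ^ ε ≤ 2 * (1 + Real.posLog x) ^ ε := by
  have h0 : 0 ≤ Real.posLog x := Real.posLog_nonneg
  have h1 : Real.posLog (2 * x) ≤ 1 + Real.posLog x := by
    have h2 : Real.posLog 2 = Real.log 2 := Real.posLog_eq_log (by norm_num)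
    have := Real.posLog_mul (x := 2) (y := x)
    have := Real.log_two_lt_d9
    linarith
  calc (1 + Real.posLog (2 * x)) ^ ε ≤ (2 * (1 + Real.posLog x)) ^ ε := by
        refine Real.rpow_le_rpow ?_ (by linarith) hε.le
        have : 0 ≤ Real.posLog (2 * x) := Real.posLog_nonneg
        linarith
    _ = 2 ^ ε * (1 + Real.posLog x) ^ ε := Real.mul_rpow (by norm_num) (by linarith)
    _ ≤ 2 * (1 + Real.posLog x) ^ ε := by
        gcongr
        calc (2 : ℝ) ^ ε ≤ 2 ^ (1 : ℝ) := Real.rpow_le_rpow_of_exponent_le (by norm_num) hε1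
          _ = 2 := Real.rpow_one _

end BergmanCommutator

open BergmanCommutator in
theorem theoremE (n : ℕ) (hn : 1 ≤ n) (θ₀ : ℝ) (hθ₀ : 0 < θ₀) (D : DyadicFamily n θ₀)
    (ε : ℝ) (hε : 0 < ε) (hε1 : ε ≤ 1) :
    ∃ C : ℝ, 0 < C ∧ ∀ b : Cn n → ℂ, MemOsc D (1 / ε) b →
      ∀ f : Cn n → ℂ, AEStronglyMeasurable f (volume.restrict (unitBall n)) →
        (∃ M : ℝ, ∀ z, ‖f z‖ ≤ M) → HasCompactSupport f → tsupport f ⊆ unitBall n →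
        ∀ lam : ℝ, 0 < lam →
          volume {z | z ∈ unitBall n ∧
              lam < ‖commutator n (fun w => (starRingEnd ℂ) (b w)) f z‖} ≤
            ENNReal.ofReal (C * oscNorm D (1 / ε) b) *
              ∫⁻ z in unitBall n, ENNReal.ofReal (‖f z‖ / lam *
                (1 + Real.posLog (‖f z‖ * oscNorm D (1 / ε) b / lam)) ^ ε) := by
  obtain ⟨C, hC, hweak⟩ := exists_weak_type_of_expOscSup_le hn hθ₀ D hε hε1
  refine ⟨4 * C, by positivity, fun b hb f hf hfb hfc hfs lam hlam => ?_⟩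
  obtain ⟨c₀, hc₀⟩ := exists_expOscSup_le_two D (by positivity : 0 < 1 / ε) hb
  set s : Set ℝ := {c : ℝ | 0 < c ∧ expOscSup D b (1 / ε) c ≤ 2} with hs
  have hne : s.Nonempty := ⟨c₀, hc₀⟩
  have hbound : ∀ c ∈ s, _ := fun c hc => hweak b c hb.1 hc.1 hc.2 f hf hfb hfc hfs lam hlam
  set N := oscNorm D (1 / ε) b with hN
  have hN0 : 0 ≤ N := Real.sInf_nonneg fun c hc => hc.1.le
  -- The infimum need not be attained. If it vanishes, admissible `c` tend to `0` while the integral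
  -- stays bounded, so the level set is null. Otherwise some admissible `c` is below `2N`, which
  -- costs one factor `2` outside and another inside the logarithmic integrand.
  rcases hN0.eq_or_lt with h0 | hpos
  · obtain ⟨M, hM⟩ := hfb
    rw [← h0, mul_zero, ENNReal.ofReal_zero, zero_mul, nonpos_iff_eq_zero]
    have hlim : Filter.Tendsto (fun k : ℕ => ENNReal.ofReal (C * (1 / ((k : ℝ) + 1))) *
        ∫⁻ z in unitBall n, ENNReal.ofReal (‖f z‖ / lam *
          (1 + Real.posLog (‖f z‖ * 1 / lam)) ^ ε)) Filter.atTop (nhds 0) := by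
      have hfin : ∫⁻ z in unitBall n, ENNReal.ofReal (‖f z‖ / lam *
          (1 + Real.posLog (‖f z‖ * 1 / lam)) ^ ε) ≠ ⊤ := by
        refine ((lintegral_mono (g := fun _ => ENNReal.ofReal (M / lam *
          (1 + Real.posLog (M * 1 / lam)) ^ ε)) fun z => ?_).trans_lt ?_).ne
        · have h1 := hM z
          have h2 : Real.posLog (‖f z‖ * 1 / lam) ≤ Real.posLog (M * 1 / lam) :=
            Real.posLog_le_posLog (by positivity) (by gcongr)
          have h3 : 0 ≤ Real.posLog (‖f z‖ * 1 / lam) := Real.posLog_nonneg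
          have h4 : 0 ≤ M := (norm_nonneg _).trans h1
          refine ENNReal.ofReal_le_ofReal ?_
          gcongr
        · rw [lintegral_const, Measure.restrict_apply_univ]
          exact ENNReal.mul_lt_top ENNReal.ofReal_lt_top measure_ball_lt_top
      have h1 : Filter.Tendsto (fun k : ℕ => ENNReal.ofReal (C * (1 / ((k : ℝ) + 1))))
          Filter.atTop (nhds 0) := by
        have := (tendsto_one_div_add_atTop_nhds_zero_nat (𝕜 := ℝ)).const_mul C
        rw [mul_zero] at this
        simpa using ENNReal.tendsto_ofReal this
      simpa using ENNReal.Tendsto.mul_const h1 (Or.inr hfin)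
    refine le_antisymm (ge_of_tendsto' hlim fun k => ?_) zero_le
    have hk : sInf s < 1 / ((k : ℝ) + 1) := by
      change N < _
      rw [← h0]; positivity
    obtain ⟨c, hc, hck⟩ := exists_lt_of_csInf_lt hne hk
    have hc1 : c ≤ 1 := by
      refine hck.le.trans ?_
      rw [div_le_one (by positivity)]
      linarith [(Nat.cast_nonneg k : (0 : ℝ) ≤ k)]
    have hc0 : 0 < c := hc.1
    refine (hbound c hc).trans ?_
    gcongr with z
    · have : 0 ≤ Real.posLog (‖f z‖ * c / lam) := Real.posLog_nonneg
      linarith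
  · obtain ⟨c, hc, hcN⟩ := exists_lt_of_csInf_lt hne (show sInf s < 2 * N by
      change N < _; linarith)
    have hc0 : 0 < c := hc.1
    refine (hbound c hc).trans ?_
    calc _ ≤ ENNReal.ofReal (C * (2 * N)) * ∫⁻ z in unitBall n, 2 * ENNReal.ofReal (‖f z‖ / lam *
          (1 + Real.posLog (‖f z‖ * N / lam)) ^ ε) := by
          gcongr with z
          rw [← ENNReal.ofReal_ofNat, ← ENNReal.ofReal_mul (by norm_num)]
          refine ENNReal.ofReal_le_ofReal ?_
          have h1 : Real.posLog (‖f z‖ * c / lam) ≤ Real.posLog (2 * (‖f z‖ * N / lam)) := by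
            refine Real.posLog_le_posLog (by positivity) ?_
            rw [← mul_div_assoc, show 2 * (‖f z‖ * N) = ‖f z‖ * (2 * N) by ring]
            gcongr
          have h2 : 0 ≤ Real.posLog (‖f z‖ * c / lam) := Real.posLog_nonneg
          calc ‖f z‖ / lam * (1 + Real.posLog (‖f z‖ * c / lam)) ^ ε
              ≤ ‖f z‖ / lam * (2 * (1 + Real.posLog (‖f z‖ * N / lam)) ^ ε) := by
                gcongr
                refine le_trans ?_ (one_add_posLog_two_mul_rpow_le hε hε1)
                gcongr
            _ = _ := by ring
      _ = _ := by
          rw [lintegral_const_mul' _ _ (by norm_num), ← mul_assoc]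
          congr 1
          rw [← ENNReal.ofReal_ofNat, ← ENNReal.ofReal_mul (by positivity)]
          congr 1
          ring
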